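/- **Theorem (equivalence of joint and sequential query design, known error probabilities).** Let $d\ge 1$, let $\mathcal X\subseteq\mathbb R^d$ differ from its interior by a Lebesgue null set, and let the target $X^*$ have a prior density $p_0$ supported in $\mathcal X$ with finite differential entropy, $H(p)=-\int p\log_2 p$. In each cycle $n=0,1,2,\dots$ each of $M$ players is asked one question "is $X^*\in A$?". Admissible questions to player $m$ in cycle $n$ are the sets $A$ that are unions of at most $J_n^{(m)}$ half-open rectangles $\prod_{l=1}^d[a_l,b_l)\subseteq\mathcal X$. Given $X^*$, all past answers and the question, player $m$ gives the correct binary answer with probability $1-\epsilon_m$ and the wrong one with probability $\epsilon_m$, where $\epsilon_m\in(0,1/2)$, and the answers are conditionally independent. In a *joint* policy the batch $\mathbf A_n=(A_n^{(1)},\dots,A_n^{(M)})$ is a function of the answers of the cycles before $n$; in a *sequential* policy the question to player $m$ may depend also on the answers of players $1,\dots,m-1$ in cycle $n$. Let $p_n$ be the posterior density of $X^*$ (computed by Bayes' rule) given the answers of the cycles before $n$, and let the expected entropy loss of cycle $n$ be $H(p_n)-\mathbb E[H(p_{n+1})\mid \text{answers before cycle } n]$. Put $$C=\sum_{m=1}^M\bigl(1-h_b(\epsilon_m)\bigr),\qquad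 h_b(\epsilon)=-\epsilon\log_2\epsilon-(1-\epsilon)\log_2(1-\epsilon),$$ and let $\gamma(\mathbf A)=\{\bigcap_{m=1}^M (A^{(m)})^{i_m}: i\in\{0,1\}^M\}$, where $A^1=A$ and $A^0=A^c$. (a) Let the $J_n^{(m)}$ be arbitrary, and let $p_n$ be the posterior after any admissible (joint or sequential) past and any history of answers. Then $p_n$ is a density on $\mathcal X$ with finite entropy. Every admissible sequential bisection design for cycle $n$ (each question has probability exactly $1/2$ under the posterior current at the moment when it is asked) has expected entropy loss exactly $C$. Every admissible joint batch has expected entropy loss at most $C$, and if the loss is $C$, then each $R\in\gamma(\mathbf A)$ has posterior mass $\int_R p_n=2^{-M}$. (b) There are numbers $J_0(n)$ such that, whenever $J_n^{(m)}\ge J_0(n)$ for all $n$ and $m$, the following hold. 1. For every posterior $p_n$ as in (a), the maximal expected entropy loss of cycle $n$ over admissible joint batches and the maximal expected entropy loss over admissible sequential designs are both attained and both equal $C$. There is a sequential bisection design each of whose questions maximizes the expected entropy loss for the player asked, given the current posterior; and every admissible sequential design with this greedy optimality property has expected entropy loss $C$. 2. For every posterior $p_n$ as in (a), every jointly optimal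 batch $\mathbf A$ satisfies $\int_R p_n(x)\,dx=2^{-M}$ for all $R\in\gamma(\mathbf A)$. Moreover, if an admissible joint policy minimizes $\mathbb E[H(p_N)]$ among all admissible joint policies, then in every cycle $n<N$ and after every history its expected entropy loss is $C$ and its batch $\mathbf A_n$ satisfies $\int_R p_n(x)\,dx=2^{-M}$ for all $R\in\gamma(\mathbf A_n)$. -/

import Mathlib

open MeasureTheory

noncomputable section

namespace TwentyQuestions

variable {d M : ℕ}

/-! ### Queries -/

/-- The half-open rectangle `[a 1, b 1) × ⋯ × [a d, b d)`. -/
def rect (a b : Fin d → ℝ) : Set (Fin d → ℝ) :=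
  Set.univ.pi fun l => Set.Ico (a l) (b l)

/-- `A` is a union of at most `J` half-open rectangles contained in `𝒳` (degenerate, i.e. empty,
rectangles are allowed, so that fewer than `J` proper ones may occur). -/
def IsQueryRegion (𝒳 : Set (Fin d → ℝ)) (J : ℕ) (A : Set (Fin d → ℝ)) : Prop :=
  ∃ a b : Fin J → Fin d → ℝ,
    (∀ j, a j ≤ b j ∧ rect (a j) (b j) ⊆ 𝒳) ∧ A = ⋃ j, rect (a j) (b j)

/-- The cell `⋂ₘ (A m)^{i m}`, where `A^1 = A` and `A^0 = Aᶜ`. -/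
def cell (A : Fin M → Set (Fin d → ℝ)) (i : Fin M → Bool) : Set (Fin d → ℝ) :=
  ⋂ m, if i m = true then A m else (A m)ᶜ

/-- The dyadic partition generated by the queries `A 1, …, A M`. -/
def dyadicPartition (A : Fin M → Set (Fin d → ℝ)) : Set (Set (Fin d → ℝ)) :=
  Set.range (cell A)

/-- A query design for one cycle of `M` questions: the region asked to player `t` is a function of
the answers of the players `s < t` in this cycle. -/
abbrev SeqDesign (d M : ℕ) : Type :=
  (t : Fin M) → (Fin t → Bool) → Set (Fin d → ℝ)

/-- A batch of `M` queries fixed at the start of the cycle, i.e. a design that ignores the answers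
given within the cycle. -/
def ofJoint (A : Fin M → Set (Fin d → ℝ)) : SeqDesign d M := fun t _ => A t

/-! ### Densities and entropy (in bits) -/

/-- `p` is a probability density on `ℝ^d` that is supported in `𝒳`. -/
structure IsDensityOn (𝒳 : Set (Fin d → ℝ)) (p : (Fin d → ℝ) → ℝ) : Prop where
  nonneg : ∀ x, 0 ≤ p x
  support : ∀ x, x ∉ 𝒳 → p x = 0
  integrable : Integrable p
  integral_eq_one : ∫ x, p x = 1

/-- Differential entropy `H(p) = -∫ p log₂ p`. -/
def entropy (p : (Fin d → ℝ) → ℝ) : ℝ := -∫ x, p x * Real.logb 2 (p x)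

/-- The integral that defines `H(p)` converges absolutely. -/
def HasFiniteEntropy (p : (Fin d → ℝ) → ℝ) : Prop :=
  Integrable fun x => p x * Real.logb 2 (p x)

/-- The probability `∫_R p`. -/
def mass (p : (Fin d → ℝ) → ℝ) (R : Set (Fin d → ℝ)) : ℝ := ∫ x in R, p x

/-- Capacity `1 - h_b(ε)` (in bits) of the binary symmetric channel with crossover probability
`ε`. -/
def capacity (ε : ℝ) : ℝ := 1 - Real.binEntropy ε / Real.log 2

/-! ### The response model -/

open Classical in
/-- Probability that a player behind a binary symmetric channel with crossover probability `ε`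
answers `y` to the question "is the target in `A`?" when the target is at `x`. -/
def bsc (ε : ℝ) (A : Set (Fin d → ℝ)) (x : Fin d → ℝ) (y : Bool) : ℝ :=
  if (y = true ↔ x ∈ A) then 1 - ε else ε

/-- Probability that the first `t` players of the cycle answer `w`, given that the target is at `x`
(and given everything before the cycle). The responses are conditionally independent: each factor
is the channel of one player, applied to the query this player is asked. -/
def prefixLik (ε : Fin M → ℝ) (D : SeqDesign d M) (t : ℕ) (ht : t ≤ M) (w : Fin t → Bool)
    (x : Fin d → ℝ) : ℝ :=
  ∏ s : Fin t, bsc (ε (Fin.castLE ht s))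
    (D (Fin.castLE ht s) fun r => w (Fin.castLE s.isLt.le r)) x (w s)

/-- Probability of an observation with likelihood `L` when the target has density `p`. -/
def evidence (p L : (Fin d → ℝ) → ℝ) : ℝ := ∫ x, L x * p x

/-- Bayes' rule: the posterior density after an observation with likelihood `L`. -/
def bayes (p L : (Fin d → ℝ) → ℝ) : (Fin d → ℝ) → ℝ := fun x => L x * p x / evidence p L

/-- Likelihood of the full vector `y` of the `M` answers of one cycle. -/
def cycleLik (ε : Fin M → ℝ) (D : SeqDesign d M) (y : Fin M → Bool) : (Fin d → ℝ) → ℝ :=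
  prefixLik ε D M le_rfl y

/-- The expected entropy loss `H(p) - 𝔼[H(p⁺)]` over one cycle that starts from the density `p` and
uses the design `D`; `p⁺` is the posterior at the end of the cycle. -/
def cycleLoss (ε : Fin M → ℝ) (p : (Fin d → ℝ) → ℝ) (D : SeqDesign d M) : ℝ :=
  entropy p -
    ∑ y : Fin M → Bool, evidence p (cycleLik ε D y) * entropy (bayes p (cycleLik ε D y))

/-- The posterior within the cycle, just before player `t` is queried, given the answers `w` of the
players `s < t`. -/
def subPosterior (ε : Fin M → ℝ) (p : (Fin d → ℝ) → ℝ) (D : SeqDesign d M) (t : Fin M)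
    (w : Fin t → Bool) : (Fin d → ℝ) → ℝ :=
  bayes p (prefixLik ε D t t.isLt.le w)

/-- Each query of the cycle bisects the current posterior. -/
def IsBisection (ε : Fin M → ℝ) (p : (Fin d → ℝ) → ℝ) (D : SeqDesign d M) : Prop :=
  ∀ (t : Fin M) (w : Fin t → Bool), mass (subPosterior ε p D t w) (D t w) = 1 / 2

/-- Expected entropy loss of a single query `A` to a single player. -/
def singleLoss (ε : ℝ) (p : (Fin d → ℝ) → ℝ) (A : Set (Fin d → ℝ)) : ℝ :=
  cycleLoss (M := 1) (fun _ => ε) p (ofJoint fun _ => A)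

/-- `D` is admissible for a cycle in which player `m` may be asked about unions of at most `J m`
rectangles. -/
def SeqDesign.Admissible (𝒳 : Set (Fin d → ℝ)) (J : Fin M → ℕ) (D : SeqDesign d M) : Prop :=
  ∀ t w, IsQueryRegion 𝒳 (J t) (D t w)

/-- Coordinate-by-coordinate design: each player in turn is asked an admissible query that is
optimal for this player alone, given the current posterior. -/
def IsGreedy (𝒳 : Set (Fin d → ℝ)) (J : Fin M → ℕ) (ε : Fin M → ℝ) (p : (Fin d → ℝ) → ℝ)
    (D : SeqDesign d M) : Prop :=
  D.Admissible 𝒳 J ∧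
    ∀ (t : Fin M) (w : Fin t → Bool) (A : Set (Fin d → ℝ)), IsQueryRegion 𝒳 (J t) A →
      singleLoss (ε t) (subPosterior ε p D t w) A ≤
        singleLoss (ε t) (subPosterior ε p D t w) (D t w)

/-! ### Policies over several cycles -/

/-- The answers of the `M` players in the first `n` cycles. -/
abbrev History (M n : ℕ) : Type := Fin n → Fin M → Bool

/-- A sequential policy: in cycle `n`, after the history `h`, it uses the design `σ n h`. -/
abbrev SeqPolicy (d M : ℕ) : Type := (n : ℕ) → History M n → SeqDesign d M

/-- A joint policy: in cycle `n`, after the history `h`, it asks the batch `ζ n h` of queries. -/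
abbrev JointPolicy (d M : ℕ) : Type := (n : ℕ) → History M n → Fin M → Set (Fin d → ℝ)

/-- A joint policy regarded as a sequential one. -/
def JointPolicy.toSeq (ζ : JointPolicy d M) : SeqPolicy d M := fun n h => ofJoint (ζ n h)

/-- All queries are unions of at most `J n m` rectangles in `𝒳`. -/
def SeqPolicy.Admissible (𝒳 : Set (Fin d → ℝ)) (J : ℕ → Fin M → ℕ) (σ : SeqPolicy d M) : Prop :=
  ∀ n h, (σ n h).Admissible 𝒳 (J n)

/-- All queries are unions of at most `J n m` rectangles in `𝒳`. -/
def JointPolicy.Admissible (𝒳 : Set (Fin d → ℝ)) (J : ℕ → Fin M → ℕ) (ζ : JointPolicy d M) :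
    Prop :=
  ∀ n h m, IsQueryRegion 𝒳 (J n m) (ζ n h m)

/-- The posterior density `p_n` of the target given the history of the first `n` cycles. -/
def posterior (ε : Fin M → ℝ) (p₀ : (Fin d → ℝ) → ℝ) (σ : SeqPolicy d M) :
    (n : ℕ) → History M n → (Fin d → ℝ) → ℝ
  | 0, _ => p₀
  | n + 1, h =>
      bayes (posterior ε p₀ σ n (Fin.init h)) (cycleLik ε (σ n (Fin.init h)) (h (Fin.last n)))

/-- The probability that the history `h` of the first `n` cycles occurs. -/
def historyProb (ε : Fin M → ℝ) (p₀ : (Fin d → ℝ) → ℝ) (σ : SeqPolicy d M) :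
    (n : ℕ) → History M n → ℝ
  | 0, _ => 1
  | n + 1, h =>
      historyProb ε p₀ σ n (Fin.init h) *
        evidence (posterior ε p₀ σ n (Fin.init h))
          (cycleLik ε (σ n (Fin.init h)) (h (Fin.last n)))

/-- The expected entropy `𝔼^σ[H(p_N)]` of the posterior after `N` cycles. -/
def expectedEntropy (ε : Fin M → ℝ) (p₀ : (Fin d → ℝ) → ℝ) (σ : SeqPolicy d M) (N : ℕ) : ℝ :=
  ∑ h : History M N, historyProb ε p₀ σ N h * entropy (posterior ε p₀ σ N h)

/-- `ζ` minimizes the expected entropy after `N` cycles among all admissible joint policies. -/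
def IsOptimalJointPolicy (𝒳 : Set (Fin d → ℝ)) (J : ℕ → Fin M → ℕ) (ε : Fin M → ℝ)
    (p₀ : (Fin d → ℝ) → ℝ) (N : ℕ) (ζ : JointPolicy d M) : Prop :=
  ζ.Admissible 𝒳 J ∧
    ∀ ζ' : JointPolicy d M, ζ'.Admissible 𝒳 J →
      expectedEntropy ε p₀ ζ.toSeq N ≤ expectedEntropy ε p₀ ζ'.toSeq N

/-- The batch `A` is admissible and maximizes the expected entropy loss of a cycle that starts from
the density `p` among all admissible batches. -/
def IsOptimalBatch (𝒳 : Set (Fin d → ℝ)) (J : Fin M → ℕ) (ε : Fin M → ℝ) (p : (Fin d → ℝ) → ℝ)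
    (A : Fin M → Set (Fin d → ℝ)) : Prop :=
  (∀ m, IsQueryRegion 𝒳 (J m) (A m)) ∧
    ∀ A' : Fin M → Set (Fin d → ℝ), (∀ m, IsQueryRegion 𝒳 (J m) (A' m)) →
      cycleLoss ε p (ofJoint A') ≤ cycleLoss ε p (ofJoint A)

end TwentyQuestions

end

noncomputable section

namespace TwentyQuestions

variable {d M : ℕ} {𝒳 : Set (Fin d → ℝ)} {p L L₁ L₂ : (Fin d → ℝ) → ℝ} {c c₁ : ℝ}

/-! ### Likelihoods and Bayes' rule -/

/-! The entropy loss of one query is the mutual information between target and answer. If the query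
has mass `m`, a "yes" has probability `ε + (1 - 2ε) m`, so the loss in bits is the binary entropy of
this number minus that of `ε`. It is at most `capacity ε`, with equality iff `m = 1/2`
(`singleLoss_eq_capacity_iff`).

By the chain rule (`cycleLoss_eq_sum`) the loss of a cycle is the average, over the answers heard so
far, of the single losses under the current sub-posteriors. Since no error probability vanishes,
every answer string has positive probability. Hence a design loses the sum of the capacities iff all
its queries bisect (`cycleLoss_eq_iff`), which in turn holds iff the answer vector is uniform. For a
joint batch the law of the answers is the image of the cell masses under a product of channels. Each
channel is an invertible 2×2 matrix and, like its inverse, has row sums 1, so uniform answers and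
uniform cells are equivalent (`cycleLoss_ofJoint_eq_iff`).

For attainment, cut a finite union of rectangles by parallel hyperplanes into slabs of mass `2⁻ᴹ`,
and let query `m` collect the slabs whose label has bit `m` set (`exists_equalizing_batch`). The
number of rectangles can be fixed in advance, because every posterior of cycle `n` is at most a
constant, depending on `n` but not on policy or history, times `p₀`: rectangles that almost exhaust
`p₀` almost exhaust all these posteriors.

Over `N` cycles the expected entropy telescopes, so the gap to the bound `H(p₀) - N C` is a
positively weighted sum of nonnegative deficits. A policy built cycle by cycle closes the gap, so an
optimal one has every deficit zero. -/

/-- `L` is a measurable likelihood with values in `[c, 1]`. -/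
structure IsLikelihood (c : ℝ) (L : (Fin d → ℝ) → ℝ) : Prop where
  measurable : Measurable L
  le : ∀ x, c ≤ L x
  le_one : ∀ x, L x ≤ 1

namespace IsLikelihood

lemma norm_le (hL : IsLikelihood c L) (hc : 0 < c) (x : Fin d → ℝ) : ‖L x‖ ≤ 1 := by
  rw [Real.norm_of_nonneg (hc.le.trans (hL.le x))]
  exact hL.le_one x

lemma integrable_mul (hL : IsLikelihood c L) (hc : 0 < c) {f : (Fin d → ℝ) → ℝ}
    (hf : Integrable f) : Integrable fun x => L x * f x :=
  hf.bdd_mul hL.measurable.aestronglyMeasurable (.of_forall (hL.norm_le hc))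

lemma integrable_mul_logb (hL : IsLikelihood c L) (hc : 0 < c) {f : (Fin d → ℝ) → ℝ}
    (hf : Integrable f) : Integrable fun x => L x * Real.logb 2 (L x) * f x := by
  -- On `[c, 1]` the logarithm lies between `logb 2 c` and `0`, which bounds `L log L`.
  refine hf.bdd_mul (c := -Real.logb 2 c)
    (by unfold Real.logb; have := hL.measurable; fun_prop) (.of_forall fun x => ?_)
  have h0 : 0 < L x := hc.trans_le (hL.le x)
  have h1 : Real.logb 2 (L x) ≤ 0 := Real.logb_nonpos one_lt_two h0.le (hL.le_one x)
  have h2 : Real.logb 2 c ≤ Real.logb 2 (L x) := Real.logb_le_logb_of_le one_lt_two hc (hL.le x)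
  rw [norm_mul, Real.norm_of_nonneg h0.le, Real.norm_of_nonpos h1]
  have := hL.le_one x
  nlinarith

lemma le_evidence (hL : IsLikelihood c L) (hc : 0 < c) (hp : IsDensityOn 𝒳 p) :
    c ≤ evidence p L := by
  calc c = ∫ x, c * p x := by rw [integral_const_mul, hp.integral_eq_one, mul_one]
    _ ≤ evidence p L := integral_mono (hp.integrable.const_mul c)
        (hL.integrable_mul hc hp.integrable)
        fun x => mul_le_mul_of_nonneg_right (hL.le x) (hp.nonneg x)

lemma evidence_pos (hL : IsLikelihood c L) (hc : 0 < c) (hp : IsDensityOn 𝒳 p) :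
    0 < evidence p L :=
  hc.trans_le (hL.le_evidence hc hp)

lemma bayes_le (hL : IsLikelihood c L) (hc : 0 < c) (hp : IsDensityOn 𝒳 p) (x : Fin d → ℝ) :
    bayes p L x ≤ c⁻¹ * p x := by
  have he := hL.le_evidence hc hp
  rw [bayes, div_le_iff₀ (hc.trans_le he)]
  have h1 : 1 ≤ c⁻¹ * evidence p L := by
    rw [inv_mul_eq_div, one_le_div hc]; exact he
  have h2 := hL.le_one x
  have h3 := hp.nonneg x
  nlinarith

lemma isDensityOn_bayes (hL : IsLikelihood c L) (hc : 0 < c) (hp : IsDensityOn 𝒳 p) :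
    IsDensityOn 𝒳 (bayes p L) where
  nonneg x := div_nonneg (mul_nonneg (hc.le.trans (hL.le x)) (hp.nonneg x))
    (hL.evidence_pos hc hp).le
  support x hx := by simp [bayes, hp.support x hx]
  integrable := (hL.integrable_mul hc hp.integrable).div_const _
  integral_eq_one := by
    unfold bayes
    rw [integral_div]
    exact div_self (hL.evidence_pos hc hp).ne'

lemma bayes_mul_logb (hL : IsLikelihood c L) (hc : 0 < c) (hp : IsDensityOn 𝒳 p)
    (x : Fin d → ℝ) :
    evidence p L * (bayes p L x * Real.logb 2 (bayes p L x)) =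
      L x * (p x * Real.logb 2 (p x)) + L x * Real.logb 2 (L x) * p x -
        Real.logb 2 (evidence p L) * (L x * p x) := by
  have he := (hL.evidence_pos hc hp).ne'
  have h0 := (hc.trans_le (hL.le x)).ne'
  by_cases hx : p x = 0
  · simp [bayes, hx]
  · rw [bayes, Real.logb_div (mul_ne_zero h0 hx) he, Real.logb_mul h0 hx]
    field_simp
    ring

lemma hasFiniteEntropy_bayes (hL : IsLikelihood c L) (hc : 0 < c) (hp : IsDensityOn 𝒳 p)
    (hH : HasFiniteEntropy p) : HasFiniteEntropy (bayes p L) := by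
  have he := (hL.evidence_pos hc hp).ne'
  have key := (((hL.integrable_mul hc hH).add (hL.integrable_mul_logb hc hp.integrable)).sub
    ((hL.integrable_mul hc hp.integrable).const_mul (Real.logb 2 (evidence p L)))).const_mul
      (evidence p L)⁻¹
  refine key.congr (.of_forall fun x => ?_)
  simp only [Pi.add_apply, Pi.sub_apply]
  rw [← hL.bayes_mul_logb hc hp x, inv_mul_cancel_left₀ he]

/-- Splits the posterior entropy into three parts. Summed over the answers to one query, they become
the entropy of the answer, the entropy of the prior and the entropy of the noise. -/
lemma evidence_mul_entropy_bayes (hL : IsLikelihood c L) (hc : 0 < c) (hp : IsDensityOn 𝒳 p)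
    (hH : HasFiniteEntropy p) :
    evidence p L * entropy (bayes p L) =
      evidence p L * Real.logb 2 (evidence p L) - (∫ x, L x * (p x * Real.logb 2 (p x))) -
        ∫ x, L x * Real.logb 2 (L x) * p x := by
  have h1 := hL.integrable_mul hc hH
  have h2 := hL.integrable_mul_logb hc hp.integrable
  have h3 := (hL.integrable_mul hc hp.integrable).const_mul (Real.logb 2 (evidence p L))
  have h12 : Integrable fun x =>
      L x * (p x * Real.logb 2 (p x)) + L x * Real.logb 2 (L x) * p x := h1.add h2
  rw [entropy, mul_neg, ← integral_const_mul]
  simp_rw [hL.bayes_mul_logb hc hp]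
  rw [integral_sub h12 h3, integral_add h1 h2, integral_const_mul]
  simp only [evidence]
  ring

/-- With `bayes_mul`, this says that updating on two observations at once or one after the other is
the same; it drives the inductions over players. -/
lemma evidence_mul (h₁ : IsLikelihood c₁ L₁) (hc₁ : 0 < c₁) (hp : IsDensityOn 𝒳 p) :
    evidence p (fun x => L₁ x * L₂ x) = evidence p L₁ * evidence (bayes p L₁) L₂ := by
  have he := (h₁.evidence_pos hc₁ hp).ne'
  rw [evidence, evidence.eq_def (bayes p L₁), ← integral_const_mul]
  congr 1 with x
  rw [bayes]
  field_simp

lemma bayes_mul (h₁ : IsLikelihood c₁ L₁) (hc₁ : 0 < c₁) (hp : IsDensityOn 𝒳 p) :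
    bayes p (fun x => L₁ x * L₂ x) = bayes (bayes p L₁) L₂ := by
  have he := (h₁.evidence_pos hc₁ hp).ne'
  funext x
  rw [bayes, h₁.evidence_mul hc₁ hp, bayes, bayes]
  field_simp

end IsLikelihood

lemma IsDensityOn.bayes_one (hp : IsDensityOn 𝒳 p) : bayes p (fun _ => 1) = p := by
  funext x
  simp [bayes, evidence, hp.integral_eq_one]

lemma IsDensityOn.evidence_one (hp : IsDensityOn 𝒳 p) : evidence p (fun _ => 1) = 1 := by
  simp [evidence, hp.integral_eq_one]

/-! ### A single query -/

variable {ε : ℝ} {A : Set (Fin d → ℝ)}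

lemma measurableSet_rect (a b : Fin d → ℝ) : MeasurableSet (rect a b) :=
  MeasurableSet.univ_pi fun _ => measurableSet_Ico

lemma IsQueryRegion.measurableSet {J : ℕ} (h : IsQueryRegion 𝒳 J A) : MeasurableSet A := by
  obtain ⟨a, b, -, rfl⟩ := h
  exact MeasurableSet.iUnion fun j => measurableSet_rect _ _

-- Being affine in the indicator, the likelihood has an evidence affine in the mass of `A`, with
-- slope `1 - 2 * ε`.
open Classical in
lemma bsc_true (ε : ℝ) (A : Set (Fin d → ℝ)) (x : Fin d → ℝ) :
    bsc ε A x true = ε + (1 - 2 * ε) * A.indicator 1 x := by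
  by_cases hx : x ∈ A
  · simp [bsc, hx]; ring
  · simp [bsc, hx]

open Classical in
lemma bsc_false (ε : ℝ) (A : Set (Fin d → ℝ)) (x : Fin d → ℝ) :
    bsc ε A x false = 1 - bsc ε A x true := by
  by_cases hx : x ∈ A <;> simp [bsc, hx]

lemma isLikelihood_bsc (hε : ε ∈ Set.Ioo (0 : ℝ) (1 / 2)) (hA : MeasurableSet A) (y : Bool) :
    IsLikelihood ε fun x => bsc ε A x y where
  measurable := by
    have h : Measurable fun x => bsc ε A x true := by
      simp_rw [bsc_true]
      exact measurable_const.add (measurable_const.mul (measurable_one.indicator hA))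
    cases y
    · simp_rw [bsc_false]; exact measurable_const.sub h
    · exact h
  le x := by
    have := hε.2
    unfold bsc; split_ifs <;> linarith
  le_one x := by
    have := hε.1; have := hε.2
    unfold bsc; split_ifs <;> linarith

lemma mass_eq_integral_indicator (hA : MeasurableSet A) :
    mass p A = ∫ x, A.indicator 1 x * p x := by
  rw [mass, ← integral_indicator hA]
  congr 1 with x
  by_cases hx : x ∈ A <;> simp [hx]

lemma integrable_indicator_one_mul (hA : MeasurableSet A) (hp : Integrable p) :
    Integrable fun x => A.indicator 1 x * p x := by
  refine (hp.indicator hA).congr (.of_forall fun x => ?_)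
  by_cases hx : x ∈ A <;> simp [hx]

lemma evidence_bsc_true (hA : MeasurableSet A) (hp : IsDensityOn 𝒳 p) :
    evidence p (fun x => bsc ε A x true) = ε + (1 - 2 * ε) * mass p A := by
  have h := integrable_indicator_one_mul hA hp.integrable
  rw [mass_eq_integral_indicator hA, evidence]
  simp_rw [bsc_true, add_mul, mul_assoc]
  rw [integral_add (hp.integrable.const_mul _) (h.const_mul _), integral_const_mul,
    integral_const_mul, hp.integral_eq_one, mul_one]

lemma evidence_bsc_false (hA : MeasurableSet A) (hp : IsDensityOn 𝒳 p) :
    evidence p (fun x => bsc ε A x false) = 1 - evidence p (fun x => bsc ε A x true) := by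
  have h : Integrable fun x => bsc ε A x true * p x := by
    simp_rw [bsc_true, add_mul, mul_assoc]
    exact (hp.integrable.const_mul _).add
      ((integrable_indicator_one_mul hA hp.integrable).const_mul _)
  rw [evidence, evidence]
  simp_rw [bsc_false, sub_mul, one_mul]
  rw [integral_sub hp.integrable h, hp.integral_eq_one]

lemma sum_evidence_bsc (hA : MeasurableSet A) (hp : IsDensityOn 𝒳 p) :
    ∑ y : Bool, evidence p (fun x => bsc ε A x y) = 1 := by
  rw [Fintype.sum_bool, evidence_bsc_false hA hp]
  ring

lemma singleLoss_eq_sub_sum (ε : ℝ) (p : (Fin d → ℝ) → ℝ) (A : Set (Fin d → ℝ)) :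
    singleLoss ε p A = entropy p - ∑ y : Bool,
      evidence p (fun x => bsc ε A x y) * entropy (bayes p fun x => bsc ε A x y) := by
  rw [singleLoss, cycleLoss]
  congr 1
  refine Fintype.sum_equiv (Equiv.funUnique (Fin 1) Bool) _ _ fun y => ?_
  have : cycleLik (fun _ : Fin 1 => ε) (ofJoint fun _ => A) y = fun x => bsc ε A x (y 0) := by
    funext x
    simp [cycleLik, prefixLik, ofJoint]
  rw [this]
  rfl

lemma bsc_mul_logb_sum (ε : ℝ) (A : Set (Fin d → ℝ)) (x : Fin d → ℝ) :
    bsc ε A x true * Real.logb 2 (bsc ε A x true) +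
      bsc ε A x false * Real.logb 2 (bsc ε A x false) = -(Real.binEntropy ε / Real.log 2) := by
  have h1 : (1 - ε) * Real.logb 2 (1 - ε) + ε * Real.logb 2 ε =
      -(Real.binEntropy ε / Real.log 2) := by
    simp only [Real.binEntropy, Real.logb, Real.log_inv]
    ring
  by_cases hx : x ∈ A
  · simp [bsc, hx, h1]
  · simp [bsc, hx]
    linarith

/-- The expected entropy loss of a query is the mutual information of the channel. -/
lemma singleLoss_eq (hε : ε ∈ Set.Ioo (0 : ℝ) (1 / 2)) (hA : MeasurableSet A)
    (hp : IsDensityOn 𝒳 p) (hH : HasFiniteEntropy p) :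
    singleLoss ε p A =
      (Real.binEntropy (evidence p fun x => bsc ε A x true) - Real.binEntropy ε) /
        Real.log 2 := by
  have hT := isLikelihood_bsc hε hA true
  have hF := isLikelihood_bsc hε hA false
  rw [singleLoss_eq_sub_sum, Fintype.sum_bool, hT.evidence_mul_entropy_bayes hε.1 hp hH,
    hF.evidence_mul_entropy_bayes hε.1 hp hH, evidence_bsc_false hA hp]
  -- The likelihoods of the two answers add up to one.
  have h1 : (∫ x, bsc ε A x true * (p x * Real.logb 2 (p x))) +
      ∫ x, bsc ε A x false * (p x * Real.logb 2 (p x)) = -entropy p := by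
    rw [← integral_add (hT.integrable_mul hε.1 hH) (hF.integrable_mul hε.1 hH), entropy, neg_neg]
    congr 1 with x
    rw [bsc_false]; ring
  -- The channel is symmetric, so the noise entropy is the same for every target position.
  have h2 : (∫ x, bsc ε A x true * Real.logb 2 (bsc ε A x true) * p x) +
      ∫ x, bsc ε A x false * Real.logb 2 (bsc ε A x false) * p x =
        -(Real.binEntropy ε / Real.log 2) := by
    rw [← integral_add (hT.integrable_mul_logb hε.1 hp.integrable)
      (hF.integrable_mul_logb hε.1 hp.integrable)]
    simp_rw [← add_mul, bsc_mul_logb_sum]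
    rw [integral_const_mul, hp.integral_eq_one, mul_one]
  have h3 : ∀ e : ℝ, e * Real.logb 2 e + (1 - e) * Real.logb 2 (1 - e) =
      -(Real.binEntropy e / Real.log 2) := by
    intro e
    simp only [Real.binEntropy, Real.logb, Real.log_inv]
    ring
  have h4 := h3 (evidence p fun x => bsc ε A x true)
  rw [sub_div]
  linarith

lemma singleLoss_le_capacity (hε : ε ∈ Set.Ioo (0 : ℝ) (1 / 2)) (hA : MeasurableSet A)
    (hp : IsDensityOn 𝒳 p) (hH : HasFiniteEntropy p) : singleLoss ε p A ≤ capacity ε := by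
  have h2 : 0 < Real.log 2 := Real.log_pos one_lt_two
  rw [singleLoss_eq hε hA hp hH, capacity, sub_div]
  gcongr
  exact (div_le_one h2).2 Real.binEntropy_le_log_two

/-- Binary entropy reaches `log 2` only at `1/2`, and the "yes" probability is injective in the mass
because `ε ≠ 1/2`. -/
lemma singleLoss_eq_capacity_iff (hε : ε ∈ Set.Ioo (0 : ℝ) (1 / 2)) (hA : MeasurableSet A)
    (hp : IsDensityOn 𝒳 p) (hH : HasFiniteEntropy p) :
    singleLoss ε p A = capacity ε ↔ mass p A = 1 / 2 := by
  have h2 : 0 < Real.log 2 := Real.log_pos one_lt_two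
  have hε2 : (1 - 2 * ε) ≠ 0 := by linarith [hε.2]
  rw [singleLoss_eq hε hA hp hH, capacity, sub_div, sub_left_inj, div_eq_one_iff_eq h2.ne',
    Real.binEntropy_eq_log_two, evidence_bsc_true hA hp]
  constructor
  · intro h
    have : (1 - 2 * ε) * (mass p A - 1 / 2) = 0 := by linear_combination h
    have := (mul_eq_zero.1 this).resolve_left hε2
    linarith
  · intro h
    rw [h]; ring

end TwentyQuestions

end

noncomputable section

namespace TwentyQuestions

variable {d M : ℕ} {𝒳 : Set (Fin d → ℝ)} {p : (Fin d → ℝ) → ℝ}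
  {ε : Fin M → ℝ} {D : SeqDesign d M} {A : Fin M → Set (Fin d → ℝ)} {δ : ℝ}

/-! ### One cycle of queries -/

lemma sum_eq_sum_snoc {α : Type*} [Fintype α] {n : ℕ} (f : (Fin (n + 1) → α) → ℝ) :
    ∑ w, f w = ∑ v : Fin n → α, ∑ y, f (Fin.snoc v y) := by
  rw [Finset.sum_comm, ← Fintype.sum_prod_type']
  exact (Fintype.sum_equiv (Fin.snocEquiv fun _ : Fin (n + 1) => α) _ _ fun _ => rfl).symm

lemma prefixLik_zero (ε : Fin M → ℝ) (D : SeqDesign d M) (w : Fin 0 → Bool) :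
    prefixLik ε D 0 (Nat.zero_le M) w = fun _ => 1 := by
  funext x
  simp [prefixLik]

lemma prefixLik_snoc (ε : Fin M → ℝ) (D : SeqDesign d M) {t : ℕ} (ht : t + 1 ≤ M)
    (w : Fin t → Bool) (y : Bool) :
    prefixLik ε D (t + 1) ht (Fin.snoc w y) = fun x =>
      prefixLik ε D t (t.le_succ.trans ht) w x * bsc (ε ⟨t, ht⟩) (D ⟨t, ht⟩ w) x y := by
  funext x
  rw [prefixLik, Fin.prod_univ_castSucc, prefixLik]
  congr 1
  · refine Finset.prod_congr rfl fun s _ => ?_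
    have h : (fun r : Fin s => (Fin.snoc w y : Fin (t + 1) → Bool)
        (Fin.castLE s.castSucc.isLt.le r)) = fun r => w (Fin.castLE s.isLt.le r) := by
      funext r
      exact Fin.snoc_castSucc (α := fun _ => Bool) y w (Fin.castLE s.isLt.le r)
    rw [Fin.snoc_castSucc]
    exact congrArg (fun v => bsc (ε (Fin.castLE (t.le_succ.trans ht) s))
      (D (Fin.castLE (t.le_succ.trans ht) s) v) x (w s)) h
  · have h : (fun r : Fin t => (Fin.snoc w y : Fin (t + 1) → Bool)
        (Fin.castLE (Fin.last t).isLt.le r)) = w := by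
      funext r
      exact Fin.snoc_castSucc (α := fun _ => Bool) y w r
    rw [Fin.snoc_last]
    exact congrArg (fun v => bsc (ε ⟨t, ht⟩) (D ⟨t, ht⟩ v) x y) h

lemma cycleLik_ofJoint (ε : Fin M → ℝ) (A : Fin M → Set (Fin d → ℝ)) (y : Fin M → Bool)
    (x : Fin d → ℝ) :
    cycleLik ε (ofJoint A) y x = ∏ m, bsc (ε m) (A m) x (y m) :=
  rfl

lemma exists_pos_le_of_mem_Ioo (hε : ∀ m, ε m ∈ Set.Ioo (0 : ℝ) (1 / 2)) :
    ∃ δ : ℝ, 0 < δ ∧ δ ≤ 1 ∧ ∀ m, δ ≤ ε m := by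
  rcases isEmpty_or_nonempty (Fin M) with h | h
  · exact ⟨1, one_pos, le_rfl, fun m => h.elim m⟩
  · obtain ⟨m, hm⟩ := Finite.exists_min ε
    exact ⟨ε m, (hε m).1, by linarith [(hε m).2], hm⟩

/-- The lower bound uses the exponent `M` rather than `t`, so that it serves all players of the
cycle at once. -/
lemma isLikelihood_prefixLik (hε : ∀ m, ε m ∈ Set.Ioo (0 : ℝ) (1 / 2)) (hδ : 0 < δ)
    (hδ1 : δ ≤ 1) (hδε : ∀ m, δ ≤ ε m) (hD : ∀ t w, MeasurableSet (D t w)) (t : ℕ) (ht : t ≤ M)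
    (w : Fin t → Bool) : IsLikelihood (δ ^ M) (prefixLik ε D t ht w) where
  measurable := Finset.measurable_fun_prod _ fun s _ =>
    (isLikelihood_bsc (hε _) (hD _ _) _).measurable
  le x := by
    calc δ ^ M ≤ δ ^ t := pow_le_pow_of_le_one hδ.le hδ1 ht
      _ = ∏ _s : Fin t, δ := by simp
      _ ≤ _ := Finset.prod_le_prod (fun _ _ => hδ.le) fun s _ =>
          (hδε _).trans ((isLikelihood_bsc (hε _) (hD _ _) _).le x)
  le_one x := Finset.prod_le_one
    (fun s _ => (hε _).1.le.trans ((isLikelihood_bsc (hε _) (hD _ _) _).le x))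
    fun s _ => (isLikelihood_bsc (hε _) (hD _ _) _).le_one x

/-- The standing assumptions on one cycle of queries. -/
structure CycleSetup (𝒳 : Set (Fin d → ℝ)) (p : (Fin d → ℝ) → ℝ) (ε : Fin M → ℝ)
    (D : SeqDesign d M) : Prop where
  density : IsDensityOn 𝒳 p
  finiteEntropy : HasFiniteEntropy p
  error_mem : ∀ m, ε m ∈ Set.Ioo (0 : ℝ) (1 / 2)
  measurableSet : ∀ t w, MeasurableSet (D t w)

namespace CycleSetup

lemma exists_isLikelihood (S : CycleSetup 𝒳 p ε D) (t : ℕ) (ht : t ≤ M) (w : Fin t → Bool) :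
    ∃ c, 0 < c ∧ IsLikelihood c (prefixLik ε D t ht w) := by
  obtain ⟨δ, hδ, hδ1, hδε⟩ := exists_pos_le_of_mem_Ioo S.error_mem
  exact ⟨δ ^ M, pow_pos hδ M, isLikelihood_prefixLik S.error_mem hδ hδ1 hδε S.measurableSet t ht w⟩

lemma evidence_pos (S : CycleSetup 𝒳 p ε D) (t : ℕ) (ht : t ≤ M) (w : Fin t → Bool) :
    0 < evidence p (prefixLik ε D t ht w) := by
  obtain ⟨c, hc, hL⟩ := S.exists_isLikelihood t ht w
  exact hL.evidence_pos hc S.density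

lemma isDensityOn_bayes (S : CycleSetup 𝒳 p ε D) (t : ℕ) (ht : t ≤ M) (w : Fin t → Bool) :
    IsDensityOn 𝒳 (bayes p (prefixLik ε D t ht w)) := by
  obtain ⟨c, hc, hL⟩ := S.exists_isLikelihood t ht w
  exact hL.isDensityOn_bayes hc S.density

lemma hasFiniteEntropy_bayes (S : CycleSetup 𝒳 p ε D) (t : ℕ) (ht : t ≤ M)
    (w : Fin t → Bool) : HasFiniteEntropy (bayes p (prefixLik ε D t ht w)) := by
  obtain ⟨c, hc, hL⟩ := S.exists_isLikelihood t ht w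
  exact hL.hasFiniteEntropy_bayes hc S.density S.finiteEntropy

lemma isDensityOn_subPosterior (S : CycleSetup 𝒳 p ε D) (t : Fin M) (w : Fin t → Bool) :
    IsDensityOn 𝒳 (subPosterior ε p D t w) :=
  S.isDensityOn_bayes t t.isLt.le w

lemma hasFiniteEntropy_subPosterior (S : CycleSetup 𝒳 p ε D) (t : Fin M) (w : Fin t → Bool) :
    HasFiniteEntropy (subPosterior ε p D t w) :=
  S.hasFiniteEntropy_bayes t t.isLt.le w

lemma evidence_snoc (S : CycleSetup 𝒳 p ε D) {t : ℕ} (ht : t + 1 ≤ M) (w : Fin t → Bool)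
    (y : Bool) :
    evidence p (prefixLik ε D (t + 1) ht (Fin.snoc w y)) =
      evidence p (prefixLik ε D t (t.le_succ.trans ht) w) *
        evidence (subPosterior ε p D ⟨t, ht⟩ w) fun x => bsc (ε ⟨t, ht⟩) (D ⟨t, ht⟩ w) x y := by
  obtain ⟨c, hc, hL⟩ := S.exists_isLikelihood t (t.le_succ.trans ht) w
  rw [prefixLik_snoc, hL.evidence_mul hc S.density]
  rfl

lemma bayes_snoc (S : CycleSetup 𝒳 p ε D) {t : ℕ} (ht : t + 1 ≤ M) (w : Fin t → Bool)
    (y : Bool) :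
    bayes p (prefixLik ε D (t + 1) ht (Fin.snoc w y)) =
      bayes (subPosterior ε p D ⟨t, ht⟩ w) fun x => bsc (ε ⟨t, ht⟩) (D ⟨t, ht⟩ w) x y := by
  obtain ⟨c, hc, hL⟩ := S.exists_isLikelihood t (t.le_succ.trans ht) w
  rw [prefixLik_snoc, hL.bayes_mul hc S.density]
  rfl

lemma sum_evidence_snoc (S : CycleSetup 𝒳 p ε D) {t : ℕ} (ht : t + 1 ≤ M) (w : Fin t → Bool) :
    ∑ y, evidence p (prefixLik ε D (t + 1) ht (Fin.snoc w y)) =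
      evidence p (prefixLik ε D t (t.le_succ.trans ht) w) := by
  simp_rw [S.evidence_snoc ht w]
  rw [← Finset.mul_sum, sum_evidence_bsc (S.measurableSet _ _)
    (S.isDensityOn_subPosterior ⟨t, ht⟩ w), mul_one]

lemma sum_evidence (S : CycleSetup 𝒳 p ε D) (t : ℕ) (ht : t ≤ M) :
    ∑ w, evidence p (prefixLik ε D t ht w) = 1 := by
  induction t with
  | zero => simp [prefixLik_zero, S.density.evidence_one]
  | succ t ih =>
    rw [sum_eq_sum_snoc]
    simp_rw [S.sum_evidence_snoc ht]
    exact ih _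

/-- Chain rule for the entropy loss over the first `t` players. -/
lemma entropy_sub_sum_prefix (S : CycleSetup 𝒳 p ε D) (t : ℕ) (ht : t ≤ M) :
    entropy p - ∑ w, evidence p (prefixLik ε D t ht w) * entropy (bayes p (prefixLik ε D t ht w)) =
      ∑ s : Fin t, ∑ w : Fin s → Bool,
        evidence p (prefixLik ε D s (s.isLt.le.trans ht) w) *
          singleLoss (ε (Fin.castLE ht s)) (subPosterior ε p D (Fin.castLE ht s) w)
            (D (Fin.castLE ht s) w) := by
  induction t with
  | zero => simp [prefixLik_zero, S.density.evidence_one, S.density.bayes_one]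
  | succ t ih =>
    have ht' := t.le_succ.trans ht
    rw [Fin.sum_univ_castSucc]
    -- Each loss of the new player is the entropy of a sub-posterior minus its mean after one more
    -- answer; the sum telescopes.
    refine Eq.trans ?_ (congrArg (· + ∑ w : Fin t → Bool, evidence p (prefixLik ε D t ht' w) *
      singleLoss (ε ⟨t, ht⟩) (subPosterior ε p D ⟨t, ht⟩ w) (D ⟨t, ht⟩ w)) (ih ht'))
    rw [sum_eq_sum_snoc]
    simp_rw [S.evidence_snoc ht, S.bayes_snoc ht, singleLoss_eq_sub_sum, mul_sub, Finset.mul_sum,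
      Finset.sum_sub_distrib, mul_assoc]
    simp only [subPosterior]
    ring

lemma cycleLoss_eq_sum (S : CycleSetup 𝒳 p ε D) :
    cycleLoss ε p D = ∑ t : Fin M, ∑ w : Fin t → Bool,
      evidence p (prefixLik ε D t t.isLt.le w) *
        singleLoss (ε t) (subPosterior ε p D t w) (D t w) :=
  S.entropy_sub_sum_prefix M le_rfl

/-- For each player the answer probabilities sum to one, so the capacity can be moved inside the
average. This exhibits the deficit as a sum of nonnegative terms. -/
lemma sum_capacity_sub_cycleLoss (S : CycleSetup 𝒳 p ε D) :
    ∑ m, capacity (ε m) - cycleLoss ε p D = ∑ t : Fin M, ∑ w : Fin t → Bool,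
      evidence p (prefixLik ε D t t.isLt.le w) *
        (capacity (ε t) - singleLoss (ε t) (subPosterior ε p D t w) (D t w)) := by
  rw [S.cycleLoss_eq_sum, ← Finset.sum_sub_distrib]
  refine Finset.sum_congr rfl fun t _ => ?_
  simp_rw [mul_sub, Finset.sum_sub_distrib]
  rw [← Finset.sum_mul, S.sum_evidence, one_mul]

lemma evidence_mul_capacity_sub_nonneg (S : CycleSetup 𝒳 p ε D) (t : Fin M)
    (w : Fin t → Bool) :
    0 ≤ evidence p (prefixLik ε D t t.isLt.le w) *
      (capacity (ε t) - singleLoss (ε t) (subPosterior ε p D t w) (D t w)) :=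
  mul_nonneg (S.evidence_pos _ _ _).le (sub_nonneg.2 (singleLoss_le_capacity (S.error_mem t)
    (S.measurableSet t w) (S.isDensityOn_subPosterior _ _) (S.hasFiniteEntropy_subPosterior _ _)))

lemma cycleLoss_le (S : CycleSetup 𝒳 p ε D) : cycleLoss ε p D ≤ ∑ m, capacity (ε m) := by
  rw [← sub_nonneg, S.sum_capacity_sub_cycleLoss]
  exact Finset.sum_nonneg fun t _ => Finset.sum_nonneg fun w _ =>
    S.evidence_mul_capacity_sub_nonneg t w

lemma singleLoss_eq_capacity_iff (S : CycleSetup 𝒳 p ε D) (t : Fin M) (w : Fin t → Bool) :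
    singleLoss (ε t) (subPosterior ε p D t w) (D t w) = capacity (ε t) ↔
      mass (subPosterior ε p D t w) (D t w) = 1 / 2 :=
  TwentyQuestions.singleLoss_eq_capacity_iff (S.error_mem t) (S.measurableSet t w)
    (S.isDensityOn_subPosterior _ _) (S.hasFiniteEntropy_subPosterior _ _)

/-- A design achieves the total capacity exactly when it consists of bisections. -/
lemma cycleLoss_eq_iff (S : CycleSetup 𝒳 p ε D) :
    cycleLoss ε p D = ∑ m, capacity (ε m) ↔ IsBisection ε p D := by
  rw [eq_comm, ← sub_eq_zero, S.sum_capacity_sub_cycleLoss,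
    Finset.sum_eq_zero_iff_of_nonneg fun t _ => Finset.sum_nonneg fun w _ =>
      S.evidence_mul_capacity_sub_nonneg t w]
  refine forall_congr' fun t => ?_
  rw [Finset.sum_eq_zero_iff_of_nonneg fun w _ => S.evidence_mul_capacity_sub_nonneg t w]
  simp only [Finset.mem_univ, true_imp_iff]
  refine forall_congr' fun w => ?_
  -- The weights are positive, so a zero deficit forces a bisection after every answer string.
  rw [mul_eq_zero_iff_left (S.evidence_pos _ _ _).ne', sub_eq_zero, eq_comm,
    S.singleLoss_eq_capacity_iff]

lemma evidence_prefixLik_of_isBisection (S : CycleSetup 𝒳 p ε D) (hB : IsBisection ε p D)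
    (t : ℕ) (ht : t ≤ M) (w : Fin t → Bool) :
    evidence p (prefixLik ε D t ht w) = (2 : ℝ)⁻¹ ^ t := by
  induction t with
  | zero => simp [prefixLik_zero, S.density.evidence_one]
  | succ t ih =>
    have hT : evidence (subPosterior ε p D ⟨t, ht⟩ (Fin.init w))
        (fun x => bsc (ε ⟨t, ht⟩) (D ⟨t, ht⟩ (Fin.init w)) x true) = 2⁻¹ := by
      rw [evidence_bsc_true (S.measurableSet _ _) (S.isDensityOn_subPosterior _ _),
        hB ⟨t, ht⟩ (Fin.init w)]
      ring
    rw [← Fin.snoc_init_self w, S.evidence_snoc ht, ih, pow_succ]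
    congr 1
    cases w (Fin.last t)
    · rw [evidence_bsc_false (S.measurableSet _ _) (S.isDensityOn_subPosterior _ _), hT]
      norm_num
    · exact hT

lemma evidence_prefixLik_of_uniform (S : CycleSetup 𝒳 p ε D)
    (hU : ∀ y, evidence p (cycleLik ε D y) = (2 : ℝ)⁻¹ ^ M) (t : ℕ) (ht : t ≤ M)
    (w : Fin t → Bool) : evidence p (prefixLik ε D t ht w) = (2 : ℝ)⁻¹ ^ t := by
  induction ht using Nat.decreasingInduction with
  | self => exact hU w
  | of_succ t ht ih =>
    rw [← S.sum_evidence_snoc ht w]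
    simp_rw [ih]
    rw [Fintype.sum_bool, pow_succ]
    ring

/-- Prefixes of a uniform vector are uniform, so each "yes" has conditional probability `1/2`; this
determines the mass because `ε t ≠ 1/2`. -/
lemma isBisection_of_uniform (S : CycleSetup 𝒳 p ε D)
    (hU : ∀ y, evidence p (cycleLik ε D y) = (2 : ℝ)⁻¹ ^ M) : IsBisection ε p D := by
  intro t w
  have h : _ = _ * evidence (subPosterior ε p D t w) fun x => bsc (ε t) (D t w) x true :=
    S.evidence_snoc t.isLt w true
  rw [S.evidence_prefixLik_of_uniform hU, S.evidence_prefixLik_of_uniform hU, pow_succ,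
    mul_right_inj' (by positivity),
    evidence_bsc_true (S.measurableSet t w) (S.isDensityOn_subPosterior _ _)] at h
  have hε2 : (1 - 2 * ε t) ≠ 0 := by linarith [(S.error_mem t).2]
  have h0 : (1 - 2 * ε t) * (mass (subPosterior ε p D t w) (D t w) - 1 / 2) = 0 := by
    linear_combination -h
  linarith [(mul_eq_zero.1 h0).resolve_left hε2]

end CycleSetup

/-! ### Joint batches -/

open Classical in
/-- The indicator of the event that membership of `x` in `A` is described by `b`. -/
def memIndicator (A : Set (Fin d → ℝ)) (b : Bool) (x : Fin d → ℝ) : ℝ :=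
  if (b = true ↔ x ∈ A) then 1 else 0

lemma mem_cell {i : Fin M → Bool} {x : Fin d → ℝ} : x ∈ cell A i ↔ ∀ m, i m = true ↔ x ∈ A m := by
  rw [cell, Set.mem_iInter]
  refine forall_congr' fun m => ?_
  by_cases h : i m = true <;> simp [h]

lemma measurableSet_cell (hA : ∀ m, MeasurableSet (A m)) (i : Fin M → Bool) :
    MeasurableSet (cell A i) :=
  MeasurableSet.iInter fun m => by
    by_cases h : i m = true
    · simpa [h] using hA m
    · simpa [h] using (hA m).compl

lemma prod_memIndicator (A : Fin M → Set (Fin d → ℝ)) (i : Fin M → Bool) (x : Fin d → ℝ) :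
    ∏ m, memIndicator (A m) (i m) x = (cell A i).indicator 1 x := by
  classical
  simp only [memIndicator, Finset.prod_ite_zero, Finset.prod_const_one, Finset.mem_univ,
    true_imp_iff, Set.indicator_apply, mem_cell, Pi.one_apply]

lemma sum_mass_cell (hA : ∀ m, MeasurableSet (A m)) (hp : IsDensityOn 𝒳 p) :
    ∑ i, mass p (cell A i) = 1 := by
  simp_rw [mass_eq_integral_indicator (measurableSet_cell hA _)]
  rw [← integral_finsetSum _ fun i _ =>
    integrable_indicator_one_mul (measurableSet_cell hA i) hp.integrable, ← hp.integral_eq_one]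
  congr 1 with x
  simp_rw [← prod_memIndicator]
  rw [← Finset.sum_mul, ← Fintype.piFinset_univ,
    ← Finset.prod_univ_sum (fun _ => Finset.univ) fun m b => memIndicator (A m) b x]
  have : ∀ m, ∑ b, memIndicator (A m) b x = 1 := by
    intro m
    by_cases h : x ∈ A m <;> simp [memIndicator, h]
  simp only [this, Finset.prod_const_one, one_mul]

/-- Passing a vector of observables through independent channels with stochastic kernels preserves
the uniform law. -/
lemma integral_prod_eq_of_kernel {f g : Fin M → Bool → (Fin d → ℝ) → ℝ}
    (K : Fin M → Bool → Bool → ℝ) (hK : ∀ m a, ∑ b, K m a b = 1)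
    (hf : ∀ m a x, f m a x = ∑ b, K m a b * g m b x) {v : ℝ}
    (hint : ∀ j : Fin M → Bool, Integrable fun x => (∏ m, g m (j m) x) * p x)
    (hg : ∀ j : Fin M → Bool, ∫ x, (∏ m, g m (j m) x) * p x = v) (i : Fin M → Bool) :
    ∫ x, (∏ m, f m (i m) x) * p x = v := by
  have h1 : ∀ x, (∏ m, f m (i m) x) * p x =
      ∑ j : Fin M → Bool, (∏ m, K m (i m) (j m)) * ((∏ m, g m (j m) x) * p x) := by
    intro x
    simp_rw [hf]
    rw [Finset.prod_univ_sum, Fintype.piFinset_univ, Finset.sum_mul]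
    refine Finset.sum_congr rfl fun j _ => ?_
    rw [Finset.prod_mul_distrib]
    ring
  simp_rw [h1]
  rw [integral_finsetSum _ fun j _ => (hint j).const_mul _]
  simp_rw [integral_const_mul, hg]
  -- Only the row sums of `K` matter. Its entries may be negative, which admits the inverse of a
  -- channel.
  rw [← Finset.sum_mul, ← Fintype.piFinset_univ,
    ← Finset.prod_univ_sum (fun _ => Finset.univ) fun m b => K m (i m) b]
  simp only [hK, Finset.prod_const_one, one_mul]

lemma evidence_cycleLik_of_mass_cell (hA : ∀ m, MeasurableSet (A m)) (hp : IsDensityOn 𝒳 p)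
    {v : ℝ} (h : ∀ i, mass p (cell A i) = v) (y : Fin M → Bool) :
    evidence p (cycleLik ε (ofJoint A) y) = v := by
  simp_rw [evidence, cycleLik_ofJoint]
  refine integral_prod_eq_of_kernel (f := fun m b x => bsc (ε m) (A m) x b)
    (g := fun m b x => memIndicator (A m) b x)
    (fun m a b => if a = b then 1 - ε m else ε m) (fun m a => ?_) (fun m a x => ?_)
    (fun j => ?_) (fun j => ?_) y
  · cases a <;> simp
  · by_cases hx : x ∈ A m <;> cases a <;> simp [bsc, memIndicator, hx]
  · simp_rw [prod_memIndicator]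
    exact integrable_indicator_one_mul (measurableSet_cell hA j) hp.integrable
  · simp_rw [prod_memIndicator]
    rw [← mass_eq_integral_indicator (measurableSet_cell hA j), h]

/-- The kernel is the inverse channel matrix, with entries `(1 - ε) / (1 - 2ε)` and `-ε / (1 - 2ε)`;
its rows still sum to one. -/
lemma mass_cell_of_evidence_cycleLik (S : CycleSetup 𝒳 p ε (ofJoint A)) {v : ℝ}
    (h : ∀ y, evidence p (cycleLik ε (ofJoint A) y) = v) (i : Fin M → Bool) :
    mass p (cell A i) = v := by
  have hA : ∀ m, MeasurableSet (A m) := fun m => S.measurableSet m fun _ => true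
  obtain ⟨k, hk⟩ : ∃ k : Fin M → ℝ, ∀ m, (1 - 2 * ε m) * k m = 1 :=
    ⟨fun m => (1 - 2 * ε m)⁻¹, fun m => mul_inv_cancel₀ (by linarith [(S.error_mem m).2])⟩
  rw [mass_eq_integral_indicator (measurableSet_cell hA i)]
  simp_rw [← prod_memIndicator]
  refine integral_prod_eq_of_kernel (f := fun m b x => memIndicator (A m) b x)
    (g := fun m b x => bsc (ε m) (A m) x b)
    (fun m a b => if a = b then (1 - ε m) * k m else -ε m * k m)
    (fun m a => ?_) (fun m a x => ?_) (fun j => ?_) (fun j => ?_) i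
  · cases a <;> simp <;> linear_combination hk m
  · by_cases hx : x ∈ A m <;> cases a <;> simp [bsc, memIndicator, hx] <;>
      first | ring1 | linear_combination -hk m
  · obtain ⟨c, hc, hL⟩ := S.exists_isLikelihood M le_rfl j
    exact hL.integrable_mul hc S.density.integrable
  · exact h j

/-- A joint batch achieves the total capacity exactly when it equalizes the density over its
dyadic partition. -/
lemma cycleLoss_ofJoint_eq_iff (S : CycleSetup 𝒳 p ε (ofJoint A)) :
    cycleLoss ε p (ofJoint A) = ∑ m, capacity (ε m) ↔
      ∀ i, mass p (cell A i) = (2 : ℝ)⁻¹ ^ M := by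
  rw [S.cycleLoss_eq_iff]
  constructor
  · intro hB
    exact mass_cell_of_evidence_cycleLik S fun y =>
      S.evidence_prefixLik_of_isBisection hB M le_rfl y
  · intro h
    exact S.isBisection_of_uniform (evidence_cycleLik_of_mass_cell
      (fun m => S.measurableSet m fun _ => true) S.density h)

end TwentyQuestions

end

noncomputable section

namespace TwentyQuestions

variable {d M : ℕ} {𝒳 : Set (Fin d → ℝ)} {p q : (Fin d → ℝ) → ℝ}

/-! ### Unions of rectangles -/

lemma mem_rect {a b x : Fin d → ℝ} : x ∈ rect a b ↔ ∀ l, a l ≤ x l ∧ x l < b l := by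
  simp [rect]

lemma rect_self (hd : 0 < d) (a : Fin d → ℝ) : rect a a = ∅ :=
  Set.univ_pi_eq_empty (i := ⟨0, hd⟩) (Set.Ico_self _)

/-- Cutting by a slab can produce inverted endpoints, which `IsQueryRegion` forbids; such an empty
rectangle is replaced by a degenerate one. In dimension zero no rectangle is empty. -/
lemma exists_rect_eq_of_le (hd : 0 < d) (a b : Fin d → ℝ) :
    ∃ a' b', a' ≤ b' ∧ rect a' b' = rect a b := by
  by_cases h : a ≤ b
  · exact ⟨a, b, h, rfl⟩
  · obtain ⟨l, hl⟩ : ∃ l, b l < a l := by simpa [Pi.le_def] using h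
    refine ⟨0, 0, le_rfl, ?_⟩
    rw [rect_self hd]
    exact (Set.eq_empty_iff_forall_notMem.2 fun x hx =>
      hl.not_ge ((mem_rect.1 hx l).1.trans (mem_rect.1 hx l).2.le)).symm

lemma isQueryRegion_iUnion (hd : 0 < d) {ι : Type*} [Fintype ι] {J : ℕ} {a b : ι → Fin d → ℝ}
    (h : ∀ i, rect (a i) (b i) ⊆ 𝒳) (hJ : Fintype.card ι ≤ J) :
    IsQueryRegion 𝒳 J (⋃ i, rect (a i) (b i)) := by
  obtain ⟨f⟩ : Nonempty (ι ↪ Fin J) :=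
    Function.Embedding.nonempty_of_card_le (by simpa using hJ)
  have key : ∀ j : Fin J, ∃ a' b' : Fin d → ℝ, a' ≤ b' ∧
      rect a' b' = ⋃ (i) (_ : f i = j), rect (a i) (b i) := by
    intro j
    by_cases hj : ∃ i, f i = j
    · obtain ⟨i, rfl⟩ := hj
      simpa [f.injective.eq_iff] using exists_rect_eq_of_le hd (a i) (b i)
    · push Not at hj
      exact ⟨0, 0, le_rfl, by simp [rect_self hd, hj]⟩
  choose a' b' hab hr using key
  refine ⟨a', b', fun j => ⟨hab j, ?_⟩, ?_⟩
  · rw [hr]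
    exact Set.iUnion₂_subset fun i _ => h i
  · simp_rw [hr]
    ext x
    simp

lemma exists_rect_eq_inter_slab (i₀ : Fin d) (a b : Fin d → ℝ) (s t : ℝ) :
    ∃ a' b', rect a' b' = rect a b ∩ {x | s ≤ x i₀ ∧ x i₀ < t} := by
  refine ⟨Function.update a i₀ (max (a i₀) s), Function.update b i₀ (min (b i₀) t), ?_⟩
  ext x
  simp only [Set.mem_inter_iff, mem_rect, Set.mem_ofPred_eq]
  constructor
  · intro h
    have h0 := h i₀
    simp only [Function.update_self, max_le_iff, lt_min_iff] at h0
    refine ⟨fun l => ?_, h0.1.2, h0.2.2⟩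
    rcases eq_or_ne l i₀ with rfl | hl
    · exact ⟨h0.1.1, h0.2.1⟩
    · simpa [hl] using h l
  · rintro ⟨h, hs, ht⟩ l
    rcases eq_or_ne l i₀ with rfl | hl
    · simpa using ⟨⟨(h l).1, hs⟩, (h l).2, ht⟩
    · simpa [hl] using h l

/-! ### Slicing a region by hyperplanes -/

lemma measurableSet_coord_lt (i₀ : Fin d) (s : ℝ) :
    MeasurableSet {x : Fin d → ℝ | x i₀ < s} :=
  measurableSet_lt (measurable_pi_apply i₀) measurable_const

lemma IsDensityOn.mass_mono (hp : IsDensityOn 𝒳 p) {R S : Set (Fin d → ℝ)} (h : R ⊆ S) :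
    mass p R ≤ mass p S :=
  setIntegral_mono_set hp.integrable.integrableOn (.of_forall hp.nonneg) h.eventuallyLE

/-- Hyperplanes are null sets, so the indicators of the half-spaces converge almost everywhere;
dominated convergence applies. -/
lemma continuous_mass_inter_coord_lt (hp : Integrable p) (Q : Set (Fin d → ℝ)) (i₀ : Fin d) :
    Continuous fun s => mass p (Q ∩ {x | x i₀ < s}) := by
  have h : (fun s => mass p (Q ∩ {x | x i₀ < s})) =
      fun s => ∫ x in Q, {x : Fin d → ℝ | x i₀ < s}.indicator p x := by
    funext s
    rw [mass, integral_indicator (measurableSet_coord_lt i₀ s),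
      Measure.restrict_restrict (measurableSet_coord_lt i₀ s), Set.inter_comm]
  rw [h, continuous_iff_continuousAt]
  intro s
  refine continuousAt_of_dominated (bound := fun x => ‖p x‖)
    (.of_forall fun r => hp.restrict.aestronglyMeasurable.indicator (measurableSet_coord_lt i₀ r))
    (.of_forall fun r => .of_forall fun x => norm_indicator_le_norm_self _ _) hp.restrict.norm ?_
  refine ae_restrict_of_ae ?_
  have hnull : volume {x : Fin d → ℝ | x i₀ = s} = 0 :=
    Measure.pi_hyperplane (α := fun _ => ℝ) (fun _ => volume) i₀ s
  filter_upwards [measure_eq_zero_iff_ae_notMem.1 hnull] with x hx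
  rcases lt_or_gt_of_ne (show x i₀ ≠ s from hx) with hlt | hgt
  · refine continuousAt_const (y := p x) |>.congr ?_
    filter_upwards [lt_mem_nhds hlt] with r hr
    exact (Set.indicator_of_mem (s := {x : Fin d → ℝ | x i₀ < r}) hr p).symm
  · refine continuousAt_const (y := (0 : ℝ)) |>.congr ?_
    filter_upwards [gt_mem_nhds hgt] with r hr
    exact (Set.indicator_of_notMem (s := {x : Fin d → ℝ | x i₀ < r}) (not_lt.2 hr.le) p).symm

/-- Intermediate values: finitely many rectangles are bounded in the chosen coordinate, so the mass
runs from zero to that of the whole union. -/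
lemma exists_mass_inter_coord_lt_eq (hp : IsDensityOn 𝒳 p) (i₀ : Fin d) {K : ℕ}
    (a b : Fin K → Fin d → ℝ) {v : ℝ} (hv0 : 0 ≤ v) (hv : v ≤ mass p (⋃ k, rect (a k) (b k))) :
    ∃ s, mass p ((⋃ k, rect (a k) (b k)) ∩ {x | x i₀ < s}) = v := by
  refine mem_range_of_exists_le_of_exists_ge (continuous_mass_inter_coord_lt hp.integrable _ i₀) ?_ ?_
  · obtain ⟨lo, hlo⟩ := (Set.finite_range fun k => a k i₀).bddBelow
    refine ⟨lo, ?_⟩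
    have : (⋃ k, rect (a k) (b k)) ∩ {x | x i₀ < lo} = ∅ := by
      ext x
      simp only [Set.mem_inter_iff, Set.mem_iUnion, Set.mem_ofPred_eq, Set.mem_empty_iff_false,
        iff_false, not_and, not_lt]
      rintro ⟨k, hk⟩
      exact (hlo ⟨k, rfl⟩).trans (mem_rect.1 hk i₀).1
    rw [this]
    simpa [mass] using hv0
  · obtain ⟨hi, hhi⟩ := (Set.finite_range fun k => b k i₀).bddAbove
    refine ⟨hi, ?_⟩
    rwa [Set.inter_eq_left.2]
    refine Set.iUnion_subset fun k x hx => (mem_rect.1 hx i₀).2.trans_le (hhi ⟨k, rfl⟩)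

lemma mass_inter_slab (hp : IsDensityOn 𝒳 p) {Q : Set (Fin d → ℝ)} (hQ : MeasurableSet Q)
    (i₀ : Fin d) {s t : ℝ} (hst : s ≤ t) :
    mass p (Q ∩ {x | s ≤ x i₀ ∧ x i₀ < t}) =
      mass p (Q ∩ {x | x i₀ < t}) - mass p (Q ∩ {x | x i₀ < s}) := by
  have h : Q ∩ {x | s ≤ x i₀ ∧ x i₀ < t} = (Q ∩ {x | x i₀ < t}) \ (Q ∩ {x | x i₀ < s}) := by
    ext x
    simp only [Set.mem_inter_iff, Set.mem_ofPred_eq, Set.mem_sdiff, not_and, not_lt]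
    tauto
  have hsub : Q ∩ {x | x i₀ < s} ⊆ Q ∩ {x | x i₀ < t} :=
    Set.inter_subset_inter_right _ fun x (hx : x i₀ < s) => hx.trans_le hst
  rw [h, mass, setIntegral_sdiff (hQ.inter (measurableSet_coord_lt i₀ s))
    hp.integrable.integrableOn hsub]
  rfl

/-! ### Equalizing batches and bisecting queries -/

/-- Numbers the answer patterns with the all-`false` one last. Every other pattern `i` then has both
slab boundaries `e i` and `e i + 1` among the available quantiles. -/
lemma exists_injective_lt_two_pow (M : ℕ) :
    ∃ e : (Fin M → Bool) → ℕ, Function.Injective e ∧ ∀ i m, i m = true → e i + 1 < 2 ^ M := by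
  have hcard : Fintype.card (Fin M → Bool) = 2 ^ M := by simp
  let E := Fintype.equivFinOfCardEq hcard
  let z : Fin (2 ^ M) := ⟨2 ^ M - 1, Nat.sub_lt (by positivity) one_pos⟩
  let E' := E.trans (Equiv.swap (E fun _ => false) z)
  refine ⟨fun i => E' i, fun i j h => E'.injective (Fin.ext h), fun i m him => ?_⟩
  have hz : E' (fun _ => false) = z := by simp [E']
  have hne : E' i ≠ z := by
    rw [← hz]
    intro h
    have := congrFun (E'.injective h) m
    simp [him] at this
  have h1 : (E' i : ℕ) ≠ 2 ^ M - 1 := fun h => hne (Fin.ext h)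
  have h2 := (E' i).isLt
  change (E' i : ℕ) + 1 < 2 ^ M
  omega

/-- A density that gives mass at least `1 - 2⁻ᴹ` to a union of `K` rectangles is equalized by a
batch of `M` queries, each of which is a union of at most `2ᴹ K` rectangles. -/
lemma exists_equalizing_batch (hd : 0 < d) (hp : IsDensityOn 𝒳 p) {K : ℕ}
    {a b : Fin K → Fin d → ℝ} (hsub : ∀ k, rect (a k) (b k) ⊆ 𝒳)
    (hmass : 1 - (2 : ℝ)⁻¹ ^ M ≤ mass p (⋃ k, rect (a k) (b k))) {J : Fin M → ℕ}
    (hJ : ∀ m, 2 ^ M * K ≤ J m) :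
    ∃ A : Fin M → Set (Fin d → ℝ), (∀ m, IsQueryRegion 𝒳 (J m) (A m)) ∧
      ∀ i, mass p (cell A i) = (2 : ℝ)⁻¹ ^ M := by
  set Q := ⋃ k, rect (a k) (b k) with hQdef
  have hQ : MeasurableSet Q := MeasurableSet.iUnion fun k => measurableSet_rect _ _
  let i₀ : Fin d := ⟨0, hd⟩
  let F : ℝ → ℝ := fun s => mass p (Q ∩ {x | x i₀ < s})
  have hFmono : Monotone F := fun s t hst =>
    hp.mass_mono (Set.inter_subset_inter_right _ fun x (hx : x i₀ < s) => hx.trans_le hst)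
  have hpow : (0 : ℝ) < 2⁻¹ ^ M := by positivity
  -- Quantile hyperplanes: the largest level needed is `1 - 2⁻ᴹ`, just what `hmass` supplies. From
  -- `2 ^ M` on, `s` is arbitrary.
  have hs : ∀ k : ℕ, ∃ s, k < 2 ^ M → F s = k * (2 : ℝ)⁻¹ ^ M := by
    intro k
    by_cases hk : k < 2 ^ M
    · have hle : (k : ℝ) * (2 : ℝ)⁻¹ ^ M ≤ 1 - (2 : ℝ)⁻¹ ^ M := by
        have h1 : ((k : ℝ) + 1) ≤ 2 ^ M := by exact_mod_cast hk
        have h2 : (2 : ℝ) ^ M * (2 : ℝ)⁻¹ ^ M = 1 := by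
          rw [← mul_pow, mul_inv_cancel₀ two_ne_zero, one_pow]
        nlinarith
      obtain ⟨s, hs⟩ := exists_mass_inter_coord_lt_eq hp i₀ a b (by positivity)
        (hle.trans hmass)
      exact ⟨s, fun _ => hs⟩
    · exact ⟨0, fun h => (hk h).elim⟩
  choose s hs using hs
  have hsmono : ∀ k l, k < l → l < 2 ^ M → s k < s l := by
    intro k l hkl hl
    by_contra! h
    have := hFmono h
    rw [hs l hl, hs k (hkl.trans hl)] at this
    have hkl' : (k : ℝ) < l := by exact_mod_cast hkl
    nlinarith
  obtain ⟨e, he, hlt⟩ := exists_injective_lt_two_pow M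
  let slab : (Fin M → Bool) → Set (Fin d → ℝ) := fun i =>
    {x | s (e i) ≤ x i₀ ∧ x i₀ < s (e i + 1)}
  -- Disjointness is claimed only for patterns with a `true` entry; the all-`false` slab has no
  -- meaningful upper boundary and is never used.
  have hslab : ∀ i j m l, i m = true → j l = true → ∀ x, x ∈ slab i → x ∈ slab j → i = j := by
    intro i j m l hi hj x hxi hxj
    have aux : ∀ i j l, j l = true → x ∈ slab i → x ∈ slab j → ¬ e i < e j := by
      intro i j l hj hxi hxj hij
      have h1 : s (e i + 1) ≤ s (e j) := by
        rcases (Nat.succ_le_of_lt hij).eq_or_lt with h | h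
        · exact (congrArg s h).le
        · exact (hsmono _ _ h ((Nat.lt_succ_self _).trans (hlt j l hj))).le
      exact absurd (hxi.2.trans_le h1) (not_lt.2 hxj.1)
    by_contra hne
    rcases lt_or_gt_of_ne (fun h => hne (he h)) with h | h
    · exact aux i j l hj hxi hxj h
    · exact aux j i m hi hxj hxi h
  have hrect : ∀ (m : Fin M) (ik : (Fin M → Bool) × Fin K), ∃ a' b' : Fin d → ℝ,
      rect a' b' = {x | ik.1 m = true ∧ x ∈ rect (a ik.2) (b ik.2) ∩ slab ik.1} := by
    intro m ik
    by_cases h : ik.1 m = true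
    · simpa [h] using exists_rect_eq_inter_slab i₀ (a ik.2) (b ik.2) (s (e ik.1)) (s (e ik.1 + 1))
    · exact ⟨0, 0, by simp [h, rect_self hd]⟩
  choose a' b' hr using hrect
  let A : Fin M → Set (Fin d → ℝ) := fun m => ⋃ ik, rect (a' m ik) (b' m ik)
  have hAreg : ∀ m, IsQueryRegion 𝒳 (J m) (A m) := by
    intro m
    refine isQueryRegion_iUnion hd (fun ik => ?_) (by simpa using hJ m)
    rw [hr]
    exact fun x hx => hsub _ hx.2.1
  have hAmem : ∀ m x, x ∈ A m ↔ x ∈ Q ∧ ∃ i, i m = true ∧ x ∈ slab i := by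
    intro m x
    simp only [A, Set.mem_iUnion, hr, Prod.exists, Set.mem_ofPred_eq, Set.mem_inter_iff, hQdef]
    constructor
    · rintro ⟨i, k, him, hk, hx⟩
      exact ⟨⟨k, hk⟩, i, him, hx⟩
    · rintro ⟨⟨k, hk⟩, i, him, hx⟩
      exact ⟨i, k, him, hk, hx⟩
  have hcell : ∀ i, i ≠ (fun _ => false) → mass p (cell A i) = (2 : ℝ)⁻¹ ^ M := by
    intro i hi
    obtain ⟨m₀, hm₀⟩ : ∃ m, i m = true := by
      by_contra! h
      exact hi (funext fun m => by simpa using h m)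
    have hci : cell A i = Q ∩ slab i := by
      ext x
      rw [mem_cell]
      constructor
      · intro h
        obtain ⟨hxQ, j, hj, hxj⟩ := (hAmem m₀ x).1 ((h m₀).1 hm₀)
        suffices i = j by subst this; exact ⟨hxQ, hxj⟩
        funext m
        rw [Bool.eq_iff_iff, h m, hAmem]
        constructor
        · rintro ⟨-, j', hj', hxj'⟩
          rwa [hslab j j' m₀ m hj hj' x hxj hxj']
        · exact fun hjm => ⟨hxQ, j, hjm, hxj⟩
      · rintro ⟨hxQ, hxi⟩ m
        rw [hAmem]
        constructor
        · exact fun him => ⟨hxQ, i, him, hxi⟩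
        · rintro ⟨-, j, hj, hxj⟩
          rwa [hslab i j m₀ m hm₀ hj x hxi hxj]
    have hl := hlt i m₀ hm₀
    have h1 : F (s (e i + 1)) = _ := hs _ hl
    have h2 : F (s (e i)) = _ := hs _ ((Nat.lt_succ_self _).trans hl)
    rw [hci, mass_inter_slab hp hQ i₀ (hsmono _ _ (Nat.lt_succ_self _) hl).le]
    change F _ - F _ = _
    rw [h1, h2]
    push_cast
    ring
  refine ⟨A, hAreg, fun i => ?_⟩
  rcases ne_or_eq i (fun _ => false) with hi | rfl
  · exact hcell i hi
  -- The all-`false` cell is everything left over, including the outside of `Q`; its mass is found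
  -- by subtraction.
  · have hsum := sum_mass_cell (fun m => (hAreg m).measurableSet) hp
    rw [← Finset.add_sum_erase _ _ (Finset.mem_univ fun _ => false),
      Finset.sum_congr rfl fun i hi => hcell i (Finset.ne_of_mem_erase hi), Finset.sum_const,
      Finset.card_erase_of_mem (Finset.mem_univ _), Finset.card_univ, nsmul_eq_mul,
      Nat.cast_sub (Fintype.card_pos)] at hsum
    have h2 : (2 : ℝ) ^ M * (2 : ℝ)⁻¹ ^ M = 1 := by
      rw [← mul_pow, mul_inv_cancel₀ two_ne_zero, one_pow]
    simp only [Fintype.card_pi, Fintype.card_bool, Finset.prod_const, Finset.card_univ,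
      Fintype.card_fin, Nat.cast_pow, Nat.cast_ofNat, Nat.cast_one] at hsum
    linarith

lemma exists_bisecting_query (hd : 0 < d) (hp : IsDensityOn 𝒳 p) {K : ℕ}
    {a b : Fin K → Fin d → ℝ} (hsub : ∀ k, rect (a k) (b k) ⊆ 𝒳)
    (hmass : 1 / 2 ≤ mass p (⋃ k, rect (a k) (b k))) {J : ℕ} (hJ : 2 * K ≤ J) :
    ∃ A, IsQueryRegion 𝒳 J A ∧ mass p A = 1 / 2 := by
  obtain ⟨A, hA, h⟩ := exists_equalizing_batch (M := 1) (J := fun _ => J) hd hp hsub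
    (by norm_num; linarith) (by simpa using hJ)
  refine ⟨A 0, hA 0, ?_⟩
  have hc : cell A (fun _ => true) = A 0 := by
    ext x
    simp [mem_cell]
  rw [← hc, h]
  norm_num

/-! ### Exhausting a density by rectangles -/

lemma exists_rect_mem_nhds_subset {U : Set (Fin d → ℝ)} (hU : IsOpen U) {x : Fin d → ℝ}
    (hx : x ∈ U) : ∃ ab : (Fin d → ℝ) × (Fin d → ℝ), rect ab.1 ab.2 ⊆ U ∧
      rect ab.1 ab.2 ∈ nhds x := by
  obtain ⟨r, hr, hrU⟩ := Metric.isOpen_iff.1 hU x hx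
  refine ⟨(fun l => x l - r / 2, fun l => x l + r / 2), fun y hy => hrU ?_, ?_⟩
  · rw [mem_rect] at hy
    rw [Metric.mem_ball, dist_pi_lt_iff hr]
    intro l
    rw [Real.dist_eq, abs_lt]
    constructor <;> linarith [(hy l).1, (hy l).2]
  · exact set_pi_mem_nhds Set.finite_univ fun l _ => Ico_mem_nhds (by linarith) (by linarith)

/-- The interior carries all the mass. Inner regularity gives a compact subset with nearly all of
it, which finitely many rectangles inside the interior cover. -/
lemma exists_rects_mass_ge (h𝒳 : volume (𝒳 \ interior 𝒳) = 0) (hp : IsDensityOn 𝒳 p) {η : ℝ}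
    (hη : 0 < η) : ∃ (K : ℕ) (a b : Fin K → Fin d → ℝ), (∀ k, rect (a k) (b k) ⊆ 𝒳) ∧
      1 - η ≤ mass p (⋃ k, rect (a k) (b k)) := by
  classical
  have hint : mass p (interior 𝒳) = 1 := by
    rw [← hp.integral_eq_one, mass, ← integral_indicator isOpen_interior.measurableSet]
    refine integral_congr_ae ?_
    filter_upwards [measure_eq_zero_iff_ae_notMem.1 h𝒳] with x hx
    by_cases hxi : x ∈ interior 𝒳
    · simp [hxi]
    · rw [Set.indicator_of_notMem hxi, hp.support x fun h => hx ⟨h, hxi⟩]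
  let ν : Measure (Fin d → ℝ) := volume.withDensity fun x => ENNReal.ofReal (p x)
  have hν : ∀ S, MeasurableSet S → ν S = ENNReal.ofReal (mass p S) := by
    intro S hS
    rw [withDensity_apply _ hS, mass, ofReal_integral_eq_lintegral_ofReal
      hp.integrable.integrableOn (.of_forall hp.nonneg)]
  have : IsFiniteMeasure ν := ⟨by rw [hν _ .univ]; exact ENNReal.ofReal_lt_top⟩
  obtain ⟨C, hCU, hC, hlt⟩ := isOpen_interior.exists_lt_isCompact (μ := ν) (U := interior 𝒳)
    (r := ENNReal.ofReal (1 - η)) (by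
      rw [hν _ isOpen_interior.measurableSet, hint]
      exact (ENNReal.ofReal_lt_ofReal_iff one_pos).2 (by linarith))
  rw [hν _ hC.measurableSet] at hlt
  have hle := (ENNReal.ofReal_lt_ofReal_iff'.1 hlt).1.le
  choose! ab hsub hnhds using fun x (hx : x ∈ interior 𝒳) =>
    exists_rect_mem_nhds_subset isOpen_interior hx
  obtain ⟨T, hT, hcov⟩ := hC.elim_nhds_subcover (fun x => rect (ab x).1 (ab x).2)
    fun x hx => hnhds x (hCU hx)
  refine ⟨T.card, fun k => (ab (T.equivFin.symm k)).1, fun k => (ab (T.equivFin.symm k)).2,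
    fun k => (hsub _ (hCU (hT _ (T.equivFin.symm k).2))).trans interior_subset,
    hle.trans (hp.mass_mono fun x hx => ?_)⟩
  obtain ⟨t, ht, hxt⟩ := Set.mem_iUnion₂.1 (hcov hx)
  exact Set.mem_iUnion.2 ⟨T.equivFin ⟨t, ht⟩, by simpa using hxt⟩

/-- Domination is applied to the complement of `Q`: what is small for `p` stays small for `q`. -/
lemma IsDensityOn.mass_ge_of_le_mul (hp : IsDensityOn 𝒳 p) (hq : IsDensityOn 𝒳 q) {κ : ℝ}
    (h : ∀ x, q x ≤ κ * p x) {Q : Set (Fin d → ℝ)} (hQ : MeasurableSet Q) :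
    1 - κ * (1 - mass p Q) ≤ mass q Q := by
  have h1 : mass p Q + mass p Qᶜ = 1 := by
    rw [← hp.integral_eq_one]; exact integral_add_compl hQ hp.integrable
  have h2 : mass q Q + mass q Qᶜ = 1 := by
    rw [← hq.integral_eq_one]; exact integral_add_compl hQ hq.integrable
  have h3 : mass q Qᶜ ≤ κ * mass p Qᶜ := by
    rw [mass, mass, ← integral_const_mul]
    exact integral_mono hq.integrable.integrableOn (hp.integrable.integrableOn.const_mul κ) h
  have h4 : 1 - mass p Q = mass p Qᶜ := by linarith
  rw [h4]
  linarith

end TwentyQuestions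

end

noncomputable section

namespace TwentyQuestions

variable {d M : ℕ} {𝒳 : Set (Fin d → ℝ)} {p₀ : (Fin d → ℝ) → ℝ} {ε : Fin M → ℝ}
  {σ : SeqPolicy d M} {δ : ℝ}

/-! ### Policies -/

lemma SeqDesign.Admissible.measurableSet {J : Fin M → ℕ} {D : SeqDesign d M}
    (hD : D.Admissible 𝒳 J) (t : Fin M) (w : Fin t → Bool) : MeasurableSet (D t w) :=
  (hD t w).measurableSet

lemma JointPolicy.Admissible.toSeq {J : ℕ → Fin M → ℕ} {ζ : JointPolicy d M}
    (hζ : ζ.Admissible 𝒳 J) : ζ.toSeq.Admissible 𝒳 J :=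
  fun n h m _ => hζ n h m

/-- The standing assumptions on a policy. -/
structure PolicySetup (𝒳 : Set (Fin d → ℝ)) (p₀ : (Fin d → ℝ) → ℝ) (ε : Fin M → ℝ)
    (σ : SeqPolicy d M) : Prop where
  density : IsDensityOn 𝒳 p₀
  finiteEntropy : HasFiniteEntropy p₀
  error_mem : ∀ m, ε m ∈ Set.Ioo (0 : ℝ) (1 / 2)
  measurableSet : ∀ n h t w, MeasurableSet (σ n h t w)

namespace PolicySetup

lemma posterior_prop (S : PolicySetup 𝒳 p₀ ε σ) (n : ℕ) (h : History M n) :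
    IsDensityOn 𝒳 (posterior ε p₀ σ n h) ∧ HasFiniteEntropy (posterior ε p₀ σ n h) := by
  induction n with
  | zero => exact ⟨S.density, S.finiteEntropy⟩
  | succ n ih =>
    have C : CycleSetup 𝒳 (posterior ε p₀ σ n (Fin.init h)) ε (σ n (Fin.init h)) :=
      ⟨(ih _).1, (ih _).2, S.error_mem, S.measurableSet n _⟩
    exact ⟨C.isDensityOn_bayes M le_rfl _, C.hasFiniteEntropy_bayes M le_rfl _⟩

lemma cycleSetup (S : PolicySetup 𝒳 p₀ ε σ) (n : ℕ) (h : History M n) {D : SeqDesign d M}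
    (hD : ∀ t w, MeasurableSet (D t w)) : CycleSetup 𝒳 (posterior ε p₀ σ n h) ε D :=
  ⟨(S.posterior_prop n h).1, (S.posterior_prop n h).2, S.error_mem, hD⟩

/-- Each cycle costs a factor `(δ ^ M)⁻¹`, whatever was asked or answered. -/
lemma posterior_le (S : PolicySetup 𝒳 p₀ ε σ) (hδ : 0 < δ) (hδ1 : δ ≤ 1) (hδε : ∀ m, δ ≤ ε m)
    (n : ℕ) (h : History M n) (x : Fin d → ℝ) :
    posterior ε p₀ σ n h x ≤ ((δ ^ M)⁻¹) ^ n * p₀ x := by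
  induction n with
  | zero => simp [posterior]
  | succ n ih =>
    rw [pow_succ', mul_assoc]
    exact ((isLikelihood_prefixLik S.error_mem hδ hδ1 hδε (S.measurableSet n _) M le_rfl
      _).bayes_le (pow_pos hδ M) (S.posterior_prop n _).1 x).trans
        (mul_le_mul_of_nonneg_left (ih _) (by positivity))

lemma subPosterior_le (S : PolicySetup 𝒳 p₀ ε σ) (hδ : 0 < δ) (hδ1 : δ ≤ 1)
    (hδε : ∀ m, δ ≤ ε m) (n : ℕ) (h : History M n) {D : SeqDesign d M}
    (hD : ∀ t w, MeasurableSet (D t w)) (t : Fin M) (w : Fin t → Bool) (x : Fin d → ℝ) :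
    subPosterior ε (posterior ε p₀ σ n h) D t w x ≤ ((δ ^ M)⁻¹) ^ (n + 1) * p₀ x := by
  rw [pow_succ', mul_assoc]
  exact ((isLikelihood_prefixLik S.error_mem hδ hδ1 hδε hD t t.isLt.le w).bayes_le
    (pow_pos hδ M) (S.posterior_prop n h).1 x).trans
      (mul_le_mul_of_nonneg_left (S.posterior_le hδ hδ1 hδε n h x) (by positivity))

lemma historyProb_pos (S : PolicySetup 𝒳 p₀ ε σ) (n : ℕ) (h : History M n) :
    0 < historyProb ε p₀ σ n h := by
  induction n with
  | zero => exact one_pos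
  | succ n ih =>
    exact mul_pos (ih _) ((S.cycleSetup n _ (S.measurableSet n _)).evidence_pos M le_rfl _)

lemma sum_historyProb (S : PolicySetup 𝒳 p₀ ε σ) (n : ℕ) :
    ∑ h, historyProb ε p₀ σ n h = 1 := by
  induction n with
  | zero => simp [historyProb]
  | succ n ih =>
    rw [sum_eq_sum_snoc]
    simp_rw [historyProb, Fin.init_snoc, Fin.snoc_last, ← Finset.mul_sum]
    rw [← ih]
    refine Finset.sum_congr rfl fun h _ => ?_
    rw [show ∑ y, evidence (posterior ε p₀ σ n h) (cycleLik ε (σ n h) y) = 1 from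
      (S.cycleSetup n h (S.measurableSet n h)).sum_evidence M le_rfl, mul_one]

lemma expectedEntropy_eq (ε : Fin M → ℝ) (p₀ : (Fin d → ℝ) → ℝ) (σ : SeqPolicy d M) (N : ℕ) :
    expectedEntropy ε p₀ σ N = entropy p₀ - ∑ n ∈ Finset.range N, ∑ h : History M n,
      historyProb ε p₀ σ n h * cycleLoss ε (posterior ε p₀ σ n h) (σ n h) := by
  induction N with
  | zero => simp [expectedEntropy, historyProb, posterior]
  | succ n ih =>
    rw [Finset.sum_range_succ, ← sub_sub, ← ih, expectedEntropy, expectedEntropy,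
      sum_eq_sum_snoc, ← Finset.sum_sub_distrib]
    refine Finset.sum_congr rfl fun h _ => ?_
    simp_rw [historyProb, posterior, Fin.init_snoc, Fin.snoc_last, mul_assoc, ← Finset.mul_sum]
    rw [cycleLoss]
    ring

lemma expectedEntropy_sub (S : PolicySetup 𝒳 p₀ ε σ) (N : ℕ) (C : ℝ) :
    expectedEntropy ε p₀ σ N - (entropy p₀ - N * C) = ∑ n ∈ Finset.range N, ∑ h : History M n,
      historyProb ε p₀ σ n h * (C - cycleLoss ε (posterior ε p₀ σ n h) (σ n h)) := by
  simp_rw [mul_sub, Finset.sum_sub_distrib, ← Finset.sum_mul, S.sum_historyProb]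
  rw [expectedEntropy_eq, Finset.sum_const, Finset.card_range, nsmul_eq_mul]
  ring

end PolicySetup

lemma posterior_congr {σ σ' : SeqPolicy d M} (n : ℕ) (h : History M n)
    (hσ : ∀ k < n, σ k = σ' k) : posterior ε p₀ σ n h = posterior ε p₀ σ' n h := by
  induction n with
  | zero => rfl
  | succ n ih =>
    rw [posterior, posterior, hσ n n.lt_succ_self, ih _ fun k hk => hσ k (hk.trans n.lt_succ_self)]

/-- If each posterior reached by an admissible joint policy admits a batch that satisfies `P`, then
some admissible joint policy asks such a batch in each of the first `N` cycles. -/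
lemma exists_jointPolicy {J : ℕ → Fin M → ℕ}
    (P : ((Fin d → ℝ) → ℝ) → (Fin M → Set (Fin d → ℝ)) → Prop)
    (ζ₀ : JointPolicy d M) (hζ₀ : ζ₀.Admissible 𝒳 J)
    (hP : ∀ ζ : JointPolicy d M, ζ.Admissible 𝒳 J → ∀ (n : ℕ) (h : History M n),
      ∃ A : Fin M → Set (Fin d → ℝ), (∀ m, IsQueryRegion 𝒳 (J n m) (A m)) ∧
        P (posterior ε p₀ ζ.toSeq n h) A) (N : ℕ) :
    ∃ ζ : JointPolicy d M, ζ.Admissible 𝒳 J ∧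
      ∀ n < N, ∀ h : History M n, P (posterior ε p₀ ζ.toSeq n h) (ζ n h) := by
  induction N with
  | zero => exact ⟨ζ₀, hζ₀, fun n hn => absurd hn n.not_lt_zero⟩
  | succ N ih =>
    obtain ⟨ζ, hζ, hN⟩ := ih
    choose A hA hPA using fun h => hP ζ hζ N h
    -- Replacing the queries of cycle `N` does not affect posteriors up to and including `p_N`, so
    -- the earlier choices keep their property.
    have hpost : ∀ n ≤ N, ∀ h : History M n,
        posterior ε p₀ (JointPolicy.toSeq (Function.update ζ N A)) n h =
          posterior ε p₀ ζ.toSeq n h := by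
      intro n hn h
      refine posterior_congr n h fun k hk => ?_
      funext g
      simp [JointPolicy.toSeq, Function.update_of_ne (hk.trans_le hn).ne]
    refine ⟨Function.update ζ N A, fun n h m => ?_, fun n hn h => ?_⟩
    · rcases eq_or_ne n N with rfl | hne
      · simpa using hA h m
      · simpa [hne] using hζ n h m
    · rw [hpost n (Nat.lt_succ_iff.1 hn)]
      rcases eq_or_ne n N with rfl | hne
      · simpa using hPA h
      · simpa [hne] using hN n (lt_of_le_of_ne (Nat.lt_succ_iff.1 hn) hne) h

/-- A number of rectangles per cycle that suffices to equalize, and to bisect, every density with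
the given bound relative to `p₀`. -/
lemma exists_rectangle_bound (hd : 0 < d) (h𝒳 : volume (𝒳 \ interior 𝒳) = 0)
    (hp₀ : IsDensityOn 𝒳 p₀) (M : ℕ) {κ : ℕ → ℝ} (hκ : ∀ n, 0 < κ n) :
    ∃ J₀ : ℕ → ℕ, ∀ n q, IsDensityOn 𝒳 q → (∀ x, q x ≤ κ n * p₀ x) →
      (∀ J : Fin M → ℕ, (∀ m, J₀ n ≤ J m) →
        ∃ A : Fin M → Set (Fin d → ℝ), (∀ m, IsQueryRegion 𝒳 (J m) (A m)) ∧
          ∀ i, mass q (cell A i) = (2 : ℝ)⁻¹ ^ M) ∧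
      ∀ J, J₀ n ≤ J → ∃ A, IsQueryRegion 𝒳 J A ∧ mass q A = 1 / 2 := by
  -- The exponent `M + 1` makes the lost mass at most both `2⁻ᴹ` and `1/2`, also for `M = 0`.
  have hη : ∀ n, 0 < (κ n)⁻¹ * (2 : ℝ)⁻¹ ^ (M + 1) := fun n =>
    mul_pos (inv_pos.2 (hκ n)) (by positivity)
  choose K a b hsub hmass using fun n => exists_rects_mass_ge h𝒳 hp₀ (hη n)
  refine ⟨fun n => 2 ^ (M + 1) * K n, fun n q hq hle => ?_⟩
  have hm : 1 - (2 : ℝ)⁻¹ ^ (M + 1) ≤ mass q (⋃ k, rect (a n k) (b n k)) := by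
    refine le_trans ?_ (hp₀.mass_ge_of_le_mul hq hle
      (MeasurableSet.iUnion fun k => measurableSet_rect _ _))
    have h1 : κ n * (1 - mass p₀ (⋃ k, rect (a n k) (b n k))) ≤
        κ n * ((κ n)⁻¹ * (2 : ℝ)⁻¹ ^ (M + 1)) :=
      mul_le_mul_of_nonneg_left (by linarith [hmass n]) (hκ n).le
    rw [mul_inv_cancel_left₀ (hκ n).ne'] at h1
    linarith
  have hpow : (0 : ℝ) < 2⁻¹ ^ M := by positivity
  have hpow1 : (2 : ℝ)⁻¹ ^ M ≤ 1 := pow_le_one₀ (by norm_num) (by norm_num)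
  rw [pow_succ] at hm
  refine ⟨fun J hJ => exists_equalizing_batch hd hq (hsub n) (by linarith) fun m => ?_,
    fun J hJ => exists_bisecting_query hd hq (hsub n) (by linarith) ?_⟩
  · exact (Nat.mul_le_mul_right _ (Nat.pow_le_pow_right two_pos M.le_succ)).trans (hJ m)
  · refine (Nat.mul_le_mul_right _ ?_).trans hJ
    rw [pow_succ]
    exact Nat.le_mul_of_pos_left _ (by positivity)

end TwentyQuestions

end

/-! ### The main theorem -/

open TwentyQuestions in
theorem theorem2 {d M : ℕ} (hd : 0 < d)
    (𝒳 : Set (Fin d → ℝ)) (h𝒳 : volume (𝒳 \ interior 𝒳) = 0)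
    (p₀ : (Fin d → ℝ) → ℝ) (hp₀ : IsDensityOn 𝒳 p₀) (hH : HasFiniteEntropy p₀)
    (ε : Fin M → ℝ) (hε : ∀ m, ε m ∈ Set.Ioo (0 : ℝ) (1 / 2)) :
    -- whatever the bounds `J` on the numbers of rectangles:
    (∀ (J : ℕ → Fin M → ℕ) (σ : SeqPolicy d M), σ.Admissible 𝒳 J →
      ∀ (n : ℕ) (h : History M n),
        IsDensityOn 𝒳 (posterior ε p₀ σ n h) ∧ HasFiniteEntropy (posterior ε p₀ σ n h) ∧
        (∀ D : SeqDesign d M, D.Admissible 𝒳 (J n) → IsBisection ε (posterior ε p₀ σ n h) D →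
          cycleLoss ε (posterior ε p₀ σ n h) D = ∑ m, capacity (ε m)) ∧
        (∀ A : Fin M → Set (Fin d → ℝ), (∀ m, IsQueryRegion 𝒳 (J n m) (A m)) →
          cycleLoss ε (posterior ε p₀ σ n h) (ofJoint A) ≤ ∑ m, capacity (ε m) ∧
          (cycleLoss ε (posterior ε p₀ σ n h) (ofJoint A) = ∑ m, capacity (ε m) →
            ∀ R ∈ dyadicPartition A, mass (posterior ε p₀ σ n h) R = (2 : ℝ)⁻¹ ^ M))) ∧
    -- whenever enough rectangles are allowed:
    ∃ J₀ : ℕ → ℕ, ∀ J : ℕ → Fin M → ℕ, (∀ n m, J₀ n ≤ J n m) →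
      (∀ σ : SeqPolicy d M, σ.Admissible 𝒳 J → ∀ (n : ℕ) (h : History M n),
        -- the optimal joint design loses `C`
        IsGreatest {c | ∃ A : Fin M → Set (Fin d → ℝ), (∀ m, IsQueryRegion 𝒳 (J n m) (A m)) ∧
          cycleLoss ε (posterior ε p₀ σ n h) (ofJoint A) = c} (∑ m, capacity (ε m)) ∧
        -- the optimal sequential design loses `C`
        IsGreatest {c | ∃ D : SeqDesign d M, D.Admissible 𝒳 (J n) ∧
          cycleLoss ε (posterior ε p₀ σ n h) D = c} (∑ m, capacity (ε m)) ∧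
        -- there is a greedy sequential design that consists of bisections
        (∃ D : SeqDesign d M, IsGreedy 𝒳 (J n) ε (posterior ε p₀ σ n h) D ∧
          IsBisection ε (posterior ε p₀ σ n h) D) ∧
        -- every greedy sequential design loses `C`
        (∀ D : SeqDesign d M, IsGreedy 𝒳 (J n) ε (posterior ε p₀ σ n h) D →
          cycleLoss ε (posterior ε p₀ σ n h) D = ∑ m, capacity (ε m)) ∧
        -- every jointly optimal batch equalizes the posterior over its dyadic partition
        (∀ A : Fin M → Set (Fin d → ℝ), IsOptimalBatch 𝒳 (J n) ε (posterior ε p₀ σ n h) A →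
          ∀ R ∈ dyadicPartition A, mass (posterior ε p₀ σ n h) R = (2 : ℝ)⁻¹ ^ M)) ∧
      -- every optimal joint policy loses `C` in each cycle, and equalizes
      (∀ (N : ℕ) (ζ : JointPolicy d M), IsOptimalJointPolicy 𝒳 J ε p₀ N ζ →
        ∀ n < N, ∀ h : History M n,
          cycleLoss ε (posterior ε p₀ ζ.toSeq n h) (ofJoint (ζ n h)) = ∑ m, capacity (ε m) ∧
          ∀ R ∈ dyadicPartition (ζ n h),
            mass (posterior ε p₀ ζ.toSeq n h) R = (2 : ℝ)⁻¹ ^ M) := by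
  have hSetup : ∀ (J : ℕ → Fin M → ℕ) (σ : SeqPolicy d M), σ.Admissible 𝒳 J →
      PolicySetup 𝒳 p₀ ε σ := fun J σ hσ =>
    ⟨hp₀, hH, hε, fun n h => (hσ n h).measurableSet⟩
  have hJoint : ∀ {J : Fin M → ℕ} {A : Fin M → Set (Fin d → ℝ)},
      (∀ m, IsQueryRegion 𝒳 (J m) (A m)) → ∀ t w, MeasurableSet (ofJoint A t w) :=
    fun hA t _ => (hA t).measurableSet
  constructor
  · intro J σ hσ n h
    have S := hSetup J σ hσ
    refine ⟨(S.posterior_prop n h).1, (S.posterior_prop n h).2, fun D hD hB => ?_,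
      fun A hA => ⟨?_, fun hC => ?_⟩⟩
    · exact (S.cycleSetup n h hD.measurableSet).cycleLoss_eq_iff.2 hB
    · exact (S.cycleSetup n h (hJoint hA)).cycleLoss_le
    · rintro R ⟨i, rfl⟩
      exact (cycleLoss_ofJoint_eq_iff (S.cycleSetup n h (hJoint hA))).1 hC i
  obtain ⟨δ, hδ, hδ1, hδε⟩ := exists_pos_le_of_mem_Ioo hε
  have hκ : 1 ≤ (δ ^ M)⁻¹ := (one_le_inv₀ (pow_pos hδ M)).2 (pow_le_one₀ hδ.le hδ1)
  -- The exponent `n + 1` also covers the sub-posteriors inside cycle `n`.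
  obtain ⟨J₀, hJ₀⟩ := exists_rectangle_bound hd h𝒳 hp₀ M (κ := fun n => ((δ ^ M)⁻¹) ^ (n + 1))
    fun n => by positivity
  refine ⟨J₀, fun J hJ => ?_⟩
  have hBatch : ∀ σ : SeqPolicy d M, σ.Admissible 𝒳 J → ∀ (n : ℕ) (h : History M n),
      ∃ A : Fin M → Set (Fin d → ℝ), (∀ m, IsQueryRegion 𝒳 (J n m) (A m)) ∧
        cycleLoss ε (posterior ε p₀ σ n h) (ofJoint A) = ∑ m, capacity (ε m) := by
    intro σ hσ n h
    have S := hSetup J σ hσ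
    obtain ⟨A, hA, hm⟩ := (hJ₀ n _ (S.posterior_prop n h).1 fun x =>
      (S.posterior_le hδ hδ1 hδε n h x).trans (mul_le_mul_of_nonneg_right
        (pow_le_pow_right₀ hκ n.le_succ) (hp₀.nonneg x))).1 (J n) (hJ n)
    exact ⟨A, hA, (cycleLoss_ofJoint_eq_iff (S.cycleSetup n h (hJoint hA))).2 hm⟩
  constructor
  · intro σ hσ n h
    have S := hSetup J σ hσ
    obtain ⟨A, hA, hC⟩ := hBatch σ hσ n h
    have hAadm : (ofJoint A).Admissible 𝒳 (J n) := fun t _ => hA t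
    have SA := S.cycleSetup n h (hJoint hA)
    have hB := SA.cycleLoss_eq_iff.1 hC
    refine ⟨⟨⟨A, hA, hC⟩, ?_⟩, ⟨⟨ofJoint A, hAadm, hC⟩, ?_⟩,
      ⟨ofJoint A, ⟨hAadm, fun t w B hBreg => ?_⟩, hB⟩, fun D hD => ?_, ?_⟩
    · rintro c ⟨B, hBreg, rfl⟩
      exact (S.cycleSetup n h (hJoint hBreg)).cycleLoss_le
    · rintro c ⟨D, hD, rfl⟩
      exact (S.cycleSetup n h hD.measurableSet).cycleLoss_le
    -- A bisection attains the capacity, which no competing query exceeds, so it is greedy.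
    · rw [(SA.singleLoss_eq_capacity_iff t w).2 (hB t w)]
      exact singleLoss_le_capacity (hε t) hBreg.measurableSet (SA.isDensityOn_subPosterior t w)
        (SA.hasFiniteEntropy_subPosterior t w)
    · have SD := S.cycleSetup n h hD.1.measurableSet
      refine SD.cycleLoss_eq_iff.2 fun t w => (SD.singleLoss_eq_capacity_iff t w).1 ?_
      -- Whatever `D` asked before, a bisecting query is still admissible, so the greedy query must
      -- reach the capacity too.
      obtain ⟨B, hBreg, hBm⟩ := (hJ₀ n _ (SD.isDensityOn_subPosterior t w)
        (S.subPosterior_le hδ hδ1 hδε n h hD.1.measurableSet t w)).2 (J n t) (hJ n t)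
      refine le_antisymm (singleLoss_le_capacity (hε t) (hD.1 t w).measurableSet
        (SD.isDensityOn_subPosterior t w) (SD.hasFiniteEntropy_subPosterior t w)) ?_
      rw [← (singleLoss_eq_capacity_iff (hε t) hBreg.measurableSet
        (SD.isDensityOn_subPosterior t w) (SD.hasFiniteEntropy_subPosterior t w)).2 hBm]
      exact hD.2 t w B hBreg
    · rintro B ⟨hBreg, hopt⟩ R ⟨i, rfl⟩
      have SB := S.cycleSetup n h (hJoint hBreg)
      exact (cycleLoss_ofJoint_eq_iff SB).1
        (le_antisymm SB.cycleLoss_le (hC ▸ hopt A hA)) i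
  · rintro N ζ ⟨hζ, hopt⟩ n hn h
    have S := hSetup J _ hζ.toSeq
    -- A competitor that attains the lower bound `H(p₀) - N C`; optimality then makes the total
    -- deficit of `ζ` zero.
    obtain ⟨ζ', hζ', hC'⟩ := exists_jointPolicy
      (fun p A => cycleLoss ε p (ofJoint A) = ∑ m, capacity (ε m)) ζ hζ
      (fun ξ hξ => hBatch ξ.toSeq hξ.toSeq) N
    have hterm : ∀ n (h : History M n), 0 ≤ historyProb ε p₀ ζ.toSeq n h *
        (∑ m, capacity (ε m) - cycleLoss ε (posterior ε p₀ ζ.toSeq n h) (ζ.toSeq n h)) :=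
      fun n h => mul_nonneg (S.historyProb_pos n h).le
        (sub_nonneg.2 (S.cycleSetup n h (S.measurableSet n h)).cycleLoss_le)
    have h0 : expectedEntropy ε p₀ ζ'.toSeq N -
        (entropy p₀ - N * ∑ m, capacity (ε m)) = 0 := by
      rw [(hSetup J _ hζ'.toSeq).expectedEntropy_sub]
      refine Finset.sum_eq_zero fun k hk => Finset.sum_eq_zero fun g _ => ?_
      have hkg : cycleLoss ε (posterior ε p₀ ζ'.toSeq k g) (ζ'.toSeq k g) = _ :=
        hC' k (Finset.mem_range.1 hk) g
      rw [hkg, sub_self, mul_zero]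
    have h1 := S.expectedEntropy_sub N (∑ m, capacity (ε m))
    have h2 := hopt ζ' hζ'
    have hsum : ∑ n ∈ Finset.range N, ∑ h : History M n, historyProb ε p₀ ζ.toSeq n h *
        (∑ m, capacity (ε m) - cycleLoss ε (posterior ε p₀ ζ.toSeq n h) (ζ.toSeq n h)) = 0 :=
      le_antisymm (by linarith)
        (Finset.sum_nonneg fun n _ => Finset.sum_nonneg fun h _ => hterm n h)
    have hloss : cycleLoss ε (posterior ε p₀ ζ.toSeq n h) (ofJoint (ζ n h)) =
        ∑ m, capacity (ε m) := by
      have h3 := (Finset.sum_eq_zero_iff_of_nonneg fun n _ =>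
        Finset.sum_nonneg fun h _ => hterm n h).1 hsum n (Finset.mem_range.2 hn)
      have h4 := (Finset.sum_eq_zero_iff_of_nonneg fun h _ => hterm n h).1 h3 h
        (Finset.mem_univ h)
      exact (sub_eq_zero.1 ((mul_eq_zero.1 h4).resolve_left (S.historyProb_pos n h).ne')).symm
    refine ⟨hloss, ?_⟩
    rintro R ⟨i, rfl⟩
    exact (cycleLoss_ofJoint_eq_iff (S.cycleSetup n h (hJoint (hζ n h)))).1 hloss i
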